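/- Work in one of three settings: smooth real manifolds, complex manifolds, or nonsingular algebraic varieties over an algebraically closed field of characteristic $0$; let $\mathbf K$ be $\mathbb R$, $\mathbb C$, or the given field, and read "function", "vector field", "curve" as smooth, holomorphic, or algebraic accordingly. **The standard chart.** Let $U$ be a chart of a surface $S$ with coordinates $r_0,n_0$ (in the algebraic setting: $(r_0,n_0)\colon U\to\mathbb A^2$ is étale), let $k\ge 0$, and let $I\subseteq\{1,\dots,k\}$ (the set of inverted positions). The corresponding standard chart of the monster space $S(k)$ is $U\times\mathbf A^k$ with coordinates $r_0,n_0,n_1,\dots,n_k$. For $1\le j\le k$ define coordinates $r_j,d_j$ recursively: if $j\notin I$, then $r_j=r_{j-1}$ and $d_j=n_{j-1}$; if $j\in I$, then $r_j=n_{j-1}$ and $d_j=r_{j-1}$. The focal sheaf $\Delta$ is the sheaf of vector fields annihilated by the forms $d(d_j)-n_j\,d(r_j)$ for $1\le j\le k$. The Lie square sequence is $\Delta_1=\Delta$, $\Delta_{i+1}=[\Delta_i,\Delta_i]$, and the small growth sequence is $\Delta^1=\Delta$, $\Delta^{h+1}=[\Delta,\Delta^{h}]$, where $[\mathcal A,\mathcal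 B]$ denotes the sheaf generated by the Lie brackets of sections of $\mathcal A$ with sections of $\mathcal B$ and by the sections of $\mathcal B$. **The special basis.** Put $v_j=\partial/\partial n_j$ for $0\le j\le k$, $f_0=\partial/\partial r_0$, and, for $1\le j\le k$, $f_j=f_{j-1}+n_jv_{j-1}$ if $j\notin I$ and $f_j=n_jf_{j-1}+v_{j-1}$ if $j\in I$. Let $g_0=f_k$, $g_1=v_k$, and, for $2\le i\le k+1$, let $g_i=\varepsilon_i v_{k-i+1}$ if $k-i+2\notin I$ and $g_i=\varepsilon_i f_{k-i+1}$ if $k-i+2\in I$. Here $\varepsilon_1=1$, and, for $1\le i\le k$, $\varepsilon_{i+1}=\varepsilon_i$ if $k-i+2\in I$ and $\varepsilon_{i+1}=-\varepsilon_i$ otherwise; these are the signs for which $[g_0,g_i]=\bigl(\prod_{h\in I,\;k-i+3\le h\le k}n_h\bigr)g_{i+1}$. **Orders.** Let $p$ be a point of the chart (a closed point, in the algebraic setting). The focal order $o(a)\in\mathbb N\cup\{\infty\}$ at $p$ of a function $a$ defined near $p$ is the minimum, over all smooth (immersed) parametrized curve germs $\gamma$ with $\gamma(0)=p$ that are tangent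 to $\Delta$, of the order of vanishing of $a\circ\gamma$ at $0$. For $2\le j\le k$ let $\mathrm{VO}_j$ be the focal order at $p$ of $n_j$ if $j\in I$, and $\mathrm{VO}_j=0$ if $j\notin I$. For $2\le i\le\min\{h,k+1\}$ let $$e_{hi}=\max\Bigl\{0,\;-(h-i)+\sum_{j=k-i+4}^{k}(i+j-k-3)\,\mathrm{VO}_j\Bigr\}.$$ **Theorem.** Let $h\ge3$, and let $z$ be a section of $\Delta^h$ over an open subset $W$ of the chart with $p\in W$. Then there are a section $w$ of $\Delta_3$ over $W$ and functions $c_{hi}$ on $W$, for $4\le i\le\min\{h,k+1\}$, such that $$z=w+\sum_{i=4}^{\min\{h,k+1\}}c_{hi}\,g_i \quad\text{on } W,$$ and the focal order of each $c_{hi}$ at $p$ is at least $e_{hi}$. -/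

import Mathlib

open scoped ContDiff Topology

universe u

namespace Monster

section Combinatorics

/-- The index of the coordinate `n_j` (`0 ≤ j ≤ k`) in the list `(r_0, n_0, n_1, …, n_k)` of the
`k + 2` standard coordinates; `r_0` has index `0`. -/
def newIdx (k j : ℕ) : Fin (k + 2) := Fin.ofNat (k + 2) (j + 1)

/-- The index of the retained coordinate `r_j`, in the chart whose set of inverted positions is
`I`. -/
def retIdx (k : ℕ) (I : Finset ℕ) : ℕ → Fin (k + 2)
  | 0 => 0
  | j + 1 => if j + 1 ∈ I then newIdx k j else retIdx k I j

/-- The index of the deactivated coordinate `d_j`, for `j ≥ 1` (the value at `0` is a dummy). -/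
def deactIdx (k : ℕ) (I : Finset ℕ) : ℕ → Fin (k + 2)
  | 0 => 0
  | j + 1 => if j + 1 ∈ I then retIdx k I j else newIdx k j

/-- The number `e_{hi}`, as a function of the vertical orders `VO_j`. Subtraction in `ℕ∞` is
truncated at `0`. -/
noncomputable def eNum (k : ℕ) (VO : ℕ → ℕ∞) (h i : ℕ) : ℕ∞ :=
  (∑ j ∈ Finset.Icc (k + 4 - i) k, ((i + j - k - 3 : ℕ) : ℕ∞) * VO j) - ((h - i : ℕ) : ℕ∞)

end Combinatorics

section StandardFields

/-! In this section `B` is the ring of functions, `M` is the module of vector fields, `x` is the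
list of coordinate functions, and `pd` is the list of coordinate vector fields `∂/∂x_i`. -/

variable {B M : Type*} [CommRing B] [AddCommGroup M] [Module B M]

/-- The standard vector field `v_j = ∂/∂n_j`. -/
def stdV (k : ℕ) (pd : Fin (k + 2) → M) (j : ℕ) : M := pd (newIdx k j)

/-- The standard vector field `f_j`. -/
def stdF (k : ℕ) (I : Finset ℕ) (x : Fin (k + 2) → B) (pd : Fin (k + 2) → M) : ℕ → M
  | 0 => pd 0
  | j + 1 =>
    if j + 1 ∈ I then x (newIdx k (j + 1)) • stdF k I x pd j + stdV k pd j
    else stdF k I x pd j + x (newIdx k (j + 1)) • stdV k pd j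

/-- The sign of `g_i`. It is determined by the requirement that `[g_0, g_i]` be `g_{i+1}` times the
product of the `n_h` with `h ∈ I` and `k - i + 3 ≤ h ≤ k`. As `[f_k, v_j]` is a product of
coordinates times `-v_{j-1}` or `-f_{j-1}`, while `[f_k, f_j]` (with `j < k`) is a product of
coordinates times `v_{j-1}` or `f_{j-1}`, this means that the sign changes from `g_i` to `g_{i+1}`
exactly if `g_i` is `± v_{k-i+1}`. -/
def spSign (k : ℕ) (I : Finset ℕ) : ℕ → ℤ
  | 0 => 1
  | 1 => 1
  | i + 2 => if k + 2 - (i + 1) ∈ I then spSign k I (i + 1) else -spSign k I (i + 1)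

/-- The special ordered basis `g_0, g_1, …, g_{k+1}` of vector fields on the chart. -/
def spG (k : ℕ) (I : Finset ℕ) (x : Fin (k + 2) → B) (pd : Fin (k + 2) → M) : ℕ → M
  | 0 => stdF k I x pd k
  | 1 => stdV k pd k
  | i + 2 =>
    if k + 2 - (i + 2) ∈ I then spSign k I (i + 2) • stdF k I x pd (k + 1 - (i + 2))
    else spSign k I (i + 2) • stdV k pd (k + 1 - (i + 2))

end StandardFields

/-! ### The smooth and the holomorphic setting -/

section Analytic

variable (𝕜 : Type*) [RCLike 𝕜]

/-- The standard chart `U × 𝕜^k` over the coordinate chart `U` of the surface. -/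
def chart (U : Set (𝕜 × 𝕜)) (k : ℕ) : Set (Fin (k + 2) → 𝕜) :=
  {y | (y 0, y 1) ∈ U}

/-- The `i`-th standard coordinate function. -/
def coordFun (k : ℕ) (i : Fin (k + 2)) : (Fin (k + 2) → 𝕜) → 𝕜 := fun y => y i

/-- The `i`-th coordinate vector field. -/
def coordVF (k : ℕ) (i : Fin (k + 2)) : (Fin (k + 2) → 𝕜) → (Fin (k + 2) → 𝕜) :=
  fun _ => Pi.single i 1

/-- The special basis on the chart. -/
def anG (k : ℕ) (I : Finset ℕ) (i : ℕ) : (Fin (k + 2) → 𝕜) → (Fin (k + 2) → 𝕜) :=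
  spG k I (coordFun 𝕜 k) (coordVF 𝕜 k) i

variable {𝕜}

/-- The tangent vector `z` at `y` is focal: it is annihilated by `d d_j - n_j d r_j` for
`j = 1, …, k`. -/
def IsFocalVec {k : ℕ} (I : Finset ℕ) (y z : Fin (k + 2) → 𝕜) : Prop :=
  ∀ j ∈ Finset.Icc 1 k, z (deactIdx k I j) = y (newIdx k j) * z (retIdx k I j)

/-- Subsheaves of the sheaf of vector fields: `𝓔 W z` means that `z` is (on `W`) a section over the
open set `W`. -/
abbrev VFSheaf (𝕜 : Type*) (k : ℕ) : Type _ :=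
  Set (Fin (k + 2) → 𝕜) → ((Fin (k + 2) → 𝕜) → (Fin (k + 2) → 𝕜)) → Prop

/-- The focal sheaf `Δ`. -/
def focalSheaf (k : ℕ) (I : Finset ℕ) : VFSheaf 𝕜 k :=
  fun W z => ContDiffOn 𝕜 ∞ z W ∧ ∀ y ∈ W, IsFocalVec I y (z y)

/-- The sheaf `[𝓐, 𝓑]` generated by the Lie brackets of sections of `𝓐` with sections of `𝓑` and by
the sections of `𝓑`. (By the product rule, the locally finite sums below are stable under
multiplication by functions.) -/
def bracketSheaf {k : ℕ} (𝓐 𝓑 : VFSheaf 𝕜 k) : VFSheaf 𝕜 k :=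
  fun W z => ContDiffOn 𝕜 ∞ z W ∧ ∀ q ∈ W, ∃ V, IsOpen V ∧ q ∈ V ∧ V ⊆ W ∧
    ∃ (m : ℕ) (a b : Fin m → (Fin (k + 2) → 𝕜) → (Fin (k + 2) → 𝕜))
      (c : (Fin (k + 2) → 𝕜) → (Fin (k + 2) → 𝕜)),
      (∀ s, 𝓐 V (a s)) ∧ (∀ s, 𝓑 V (b s)) ∧ 𝓑 V c ∧
      ∀ y ∈ V, z y = ∑ s, VectorField.lieBracket 𝕜 (a s) (b s) y + c y

/-- The Lie square sequence `Δ = Δ_1 ⊆ Δ_2 ⊆ …` (the value at `0` is a dummy). -/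
def lieSquareSheaf (k : ℕ) (I : Finset ℕ) : ℕ → VFSheaf 𝕜 k
  | 0 => focalSheaf k I
  | 1 => focalSheaf k I
  | i + 2 => bracketSheaf (lieSquareSheaf k I (i + 1)) (lieSquareSheaf k I (i + 1))

/-- The small growth sequence `Δ = Δ^1 ⊆ Δ^2 ⊆ …` (the value at `0` is a dummy). -/
def smallGrowthSheaf (k : ℕ) (I : Finset ℕ) : ℕ → VFSheaf 𝕜 k
  | 0 => focalSheaf k I
  | 1 => focalSheaf k I
  | h + 2 => bracketSheaf (focalSheaf k I) (smallGrowthSheaf k I (h + 1))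

/-- `γ` parametrizes a smooth focal curve germ through `p`. -/
def IsFocalCurve {k : ℕ} (I : Finset ℕ) (p : Fin (k + 2) → 𝕜) (γ : 𝕜 → Fin (k + 2) → 𝕜) : Prop :=
  γ 0 = p ∧ deriv γ 0 ≠ 0 ∧ ∃ ε > 0, ContDiffOn 𝕜 ∞ γ (Metric.ball 0 ε) ∧
    ∀ t ∈ Metric.ball (0 : 𝕜) ε, IsFocalVec I (γ t) (deriv γ t)

/-- The order of vanishing of `φ` at `0`; it is `⊤` if all derivatives vanish. -/
noncomputable def vanishingOrder (φ : 𝕜 → 𝕜) : ℕ∞ :=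
  ⨅ (n : ℕ) (_ : iteratedDeriv n φ 0 ≠ 0), (n : ℕ∞)

/-- The focal order at `p` of a function `a`. -/
noncomputable def focalOrder {k : ℕ} (I : Finset ℕ) (p : Fin (k + 2) → 𝕜)
    (a : (Fin (k + 2) → 𝕜) → 𝕜) : ℕ∞ :=
  ⨅ (γ : 𝕜 → Fin (k + 2) → 𝕜) (_ : IsFocalCurve I p γ), vanishingOrder (a ∘ γ)

/-- The vertical order `VO_j` at `p`: the focal order of the function defining the divisor at
infinity `I_j`, which is `n_j` if position `j` is inverted, and a unit otherwise. -/
noncomputable def verticalOrder {k : ℕ} (I : Finset ℕ) (p : Fin (k + 2) → 𝕜) (j : ℕ) : ℕ∞ :=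
  focalOrder I p (if j ∈ I then coordFun 𝕜 k (newIdx k j) else 1)

end Analytic

/-! ### The algebraic setting: rings with étale coordinates -/

section Rings

variable {K : Type*} [Field K] {B : Type*} [CommRing B] [Algebra K B]

section Frame

variable (K B) (n : ℕ) [Algebra (MvPolynomial (Fin n) K) B]
  [IsScalarTower K (MvPolynomial (Fin n) K) B]
  [Algebra.FormallyEtale (MvPolynomial (Fin n) K) B]

/-- The basis `dx_1, …, dx_n` of the Kähler differentials of a ring with étale coordinates
`x_1, …, x_n`. -/
noncomputable def dxBasis : Module.Basis (Fin n) B (Ω[B⁄K]) :=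
  ((KaehlerDifferential.mvPolynomialBasis K (Fin n)).baseChange B).map
    (KaehlerDifferential.tensorKaehlerEquivOfFormallyEtale K (MvPolynomial (Fin n) K) B)

/-- The coordinate vector field `∂/∂x_i`. -/
noncomputable def coordDer (i : Fin n) : Derivation K B B :=
  ((dxBasis K B n).coord i).compDer (KaehlerDifferential.D K B)

/-- The coordinate function `x_i`. -/
noncomputable def coordElt (i : Fin n) : B :=
  algebraMap (MvPolynomial (Fin n) K) B (MvPolynomial.X i)

theorem coordDer_coordElt (i j : Fin n) :
    coordDer K B n i (coordElt K B n j) = if i = j then 1 else 0 := by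
  have h : KaehlerDifferential.D K B (coordElt K B n j) = dxBasis K B n j := by
    simp [dxBasis, coordElt]
  change (dxBasis K B n).coord i (KaehlerDifferential.D K B (coordElt K B n j)) = _
  rw [h]
  simp [Finsupp.single_apply, eq_comm]

end Frame

/-- The module of focal vector fields. -/
def focalModule {k : ℕ} (I : Finset ℕ) (x : Fin (k + 2) → B) :
    Submodule B (Derivation K B B) where
  carrier := {z | ∀ j ∈ Finset.Icc 1 k,
    z (x (deactIdx k I j)) = x (newIdx k j) * z (x (retIdx k I j))}
  add_mem' {a b} ha hb j hj := by simp [ha j hj, hb j hj, mul_add]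
  zero_mem' := by intro j _; simp
  smul_mem' c a ha j hj := by simp [ha j hj, mul_left_comm]

/-- The module `[S, T]` generated by the Lie brackets of elements of `S` with elements of `T` and by
the elements of `T`. -/
def bracketModule (S T : Submodule B (Derivation K B B)) : Submodule B (Derivation K B B) :=
  Submodule.span B {z | ∃ a ∈ S, ∃ b ∈ T, z = ⁅a, b⁆} ⊔ T

/-- The Lie square sequence (the value at `0` is a dummy). -/
def lieSquareModule {k : ℕ} (I : Finset ℕ) (x : Fin (k + 2) → B) :
    ℕ → Submodule B (Derivation K B B)
  | 0 => focalModule I x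
  | 1 => focalModule I x
  | i + 2 => bracketModule (lieSquareModule I x (i + 1)) (lieSquareModule I x (i + 1))

/-- The small growth sequence (the value at `0` is a dummy). -/
def smallGrowthModule {k : ℕ} (I : Finset ℕ) (x : Fin (k + 2) → B) :
    ℕ → Submodule B (Derivation K B B)
  | 0 => focalModule I x
  | 1 => focalModule I x
  | h + 2 => bracketModule (focalModule I x) (smallGrowthModule I x (h + 1))

end Rings

section Curves

variable {K B : Type u} [Field K] [CommRing B] [Algebra K B]

/-- A parametrized smooth focal curve germ through the closed point `m` of an affine variety with
coordinate ring `B` and standard coordinates `x`: a smooth affine curve (coordinate ring `C`) with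
a parameter `t` (an étale coordinate) vanishing at a point `o`, and a morphism `γ` from the curve to
the variety that sends `o` to `m`, is an immersion at `o`, and is tangent to the focal
distribution. Here `d` is the derivation `d/dt`. -/
structure FocalCurve {k : ℕ} (I : Finset ℕ) (x : Fin (k + 2) → B) (m : Ideal B) where
  C : Type u
  [commRing : CommRing C]
  [algebra : Algebra K C]
  t : C
  etale : (Polynomial.aeval (R := K) t).toRingHom.Etale
  d : Derivation K C C
  d_t : d t = 1
  o : C →ₐ[K] K
  o_t : o t = 0
  γ : B →ₐ[K] C
  γ_o : RingHom.ker (o.comp γ) = m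
  immersion : ∃ i, o (d (γ (x i))) ≠ 0
  focal : ∀ j ∈ Finset.Icc 1 k,
    d (γ (x (deactIdx k I j))) = γ (x (newIdx k j)) * d (γ (x (retIdx k I j)))

attribute [instance] FocalCurve.commRing FocalCurve.algebra

/-- The order of vanishing at the point `o` of the restriction of the function `a` to a curve, as a
function of the parameter. (The characteristic will be `0`.) -/
noncomputable def FocalCurve.vanishingOrder {k : ℕ} {I : Finset ℕ} {x : Fin (k + 2) → B}
    {m : Ideal B} (Γ : FocalCurve (K := K) I x m) (a : B) : ℕ∞ :=
  ⨅ (n : ℕ) (_ : Γ.o ((fun c => Γ.d c)^[n] (Γ.γ a)) ≠ 0), (n : ℕ∞)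

variable (K) in
/-- The focal order of a function at a closed point. -/
noncomputable def algFocalOrder {k : ℕ} (I : Finset ℕ) (x : Fin (k + 2) → B) (m : Ideal B)
    (a : B) : ℕ∞ :=
  ⨅ Γ : FocalCurve (K := K) I x m, Γ.vanishingOrder a

variable (K) in
/-- The vertical order `VO_j` at a closed point. -/
noncomputable def algVerticalOrder {k : ℕ} (I : Finset ℕ) (x : Fin (k + 2) → B) (m : Ideal B)
    (j : ℕ) : ℕ∞ :=
  algFocalOrder K I x m (if j ∈ I then x (newIdx k j) else 1)

end Curves

/-! ### The algebraic setting: charts -/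

section Schemes

open AlgebraicGeometry CategoryTheory

variable (K : Type u) [Field K]

/-- `K[x_0, …, x_{n-1}]` as a commutative ring object; its spectrum is affine `n`-space. -/
noncomputable abbrev polyRing (n : ℕ) : CommRingCat.{u} := .of (MvPolynomial (Fin n) K)

/-- The identification `K[x_0, x_1, …, x_{k+1}] = K[x_0, x_1][x_2, …, x_{k+1}]`. -/
noncomputable def polySplit (k : ℕ) : MvPolynomial (Fin (k + 2)) K ≃ₐ[K]
    MvPolynomial (ULift.{u} (Fin k)) (MvPolynomial (Fin 2) K) :=
  (MvPolynomial.renameEquiv K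
    (((finCongr (Nat.add_comm k 2)).trans finSumFinEquiv.symm).trans
      ((Equiv.sumComm (Fin 2) (Fin k)).trans
        (Equiv.sumCongr Equiv.ulift.{u}.symm (Equiv.refl (Fin 2)))))).trans
  (MvPolynomial.sumAlgEquiv K (ULift.{u} (Fin k)) (Fin 2))

variable {K}

/-- The standard chart `U × 𝔸^k` over the coordinate chart `U` of the surface. -/
noncomputable abbrev algChart (U : Scheme.{u}) (k : ℕ) : Scheme.{u} := 𝔸(ULift.{u} (Fin k); U)

/-- The standard coordinates `(r_0, n_0, n_1, …, n_k)`, as a morphism from `U × 𝔸^k` to affine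
space; the coordinates on `U` are given by the morphism `φ : U ⟶ 𝔸^2`. -/
noncomputable def algCoords {U : Scheme.{u}} (φ : U ⟶ Spec (polyRing K 2)) (k : ℕ) :
    algChart U k ⟶ Spec (polyRing K (k + 2)) :=
  AffineSpace.map (ULift.{u} (Fin k)) φ ≫
    (AffineSpace.SpecIso (ULift.{u} (Fin k)) (polyRing K 2)).hom ≫
      Spec.map (CommRingCat.ofHom (polySplit K k).toAlgHom.toRingHom)

instance algCoords_etale {U : Scheme.{u}} (φ : U ⟶ Spec (polyRing K 2)) [Etale φ] (k : ℕ) :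
    Etale (algCoords φ k) := by
  have : Etale (AffineSpace.map (ULift.{u} (Fin k)) φ) :=
    MorphismProperty.of_isPullback (P := @Etale)
      (AffineSpace.isPullback_map (n := ULift.{u} (Fin k)) φ).flip ‹_›
  have : IsIso (CommRingCat.ofHom (polySplit K k).toAlgHom.toRingHom) :=
    (polySplit K k).toRingEquiv.toCommRingCatIso.isIso_hom
  unfold algCoords
  infer_instance

variable {X : Scheme.{u}} {n : ℕ}

/-- The ring of regular functions on the open set `V`, viewed as an algebra over `K` and over
`K[x_0, …, x_{n-1}]` through the coordinates `Φ`. -/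
def SecRing (_ : X ⟶ Spec (polyRing K n)) (V : X.Opens) : Type u := Γ(X, V)

section

variable (Φ : X ⟶ Spec (polyRing K n))

instance (V : X.Opens) : CommRing (SecRing Φ V) := inferInstanceAs (CommRing Γ(X, V))

/-- The pullback of polynomials in the coordinates. -/
noncomputable def coordHom (V : X.Opens) : MvPolynomial (Fin n) K →+* SecRing Φ V :=
  ((Scheme.ΓSpecIso (polyRing K n)).inv ≫ Φ.appLE ⊤ V le_top).hom

noncomputable instance (V : X.Opens) : Algebra (MvPolynomial (Fin n) K) (SecRing Φ V) :=
  (coordHom Φ V).toAlgebra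

noncomputable instance (V : X.Opens) : Algebra K (SecRing Φ V) :=
  ((coordHom Φ V).comp MvPolynomial.C).toAlgebra

instance (V : X.Opens) : IsScalarTower K (MvPolynomial (Fin n) K) (SecRing Φ V) :=
  IsScalarTower.of_algebraMap_eq' rfl

instance [Etale Φ] (V : X.affineOpens) :
    Algebra.Etale (MvPolynomial (Fin n) K) (SecRing Φ V.1) := by
  have h1 := Etale.etale_appLE Φ (isAffineOpen_top _) V.2 (le_top : V.1 ≤ Φ ⁻¹ᵁ ⊤)
  have h2 : ((Scheme.ΓSpecIso (polyRing K n)).inv).hom.Etale :=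
    RingHom.Etale.of_bijective
      (Scheme.ΓSpecIso (polyRing K n)).symm.commRingCatIsoToRingEquiv.bijective
  exact RingHom.Etale.stableUnderComposition _ _ h2 h1

/-- Restriction of functions. -/
def secRes {V W : X.Opens} (hVW : V ≤ W) : SecRing Φ W →+* SecRing Φ V :=
  (X.presheaf.map (homOfLE hVW).op).hom

/-- A vector field on the open set `W`: compatible `K`-derivations of the rings of functions of all
affine open subsets of `W`. -/
structure VectorFieldOn (W : X.Opens) where
  der : ∀ V : X.affineOpens, V.1 ≤ W → Derivation K (SecRing Φ V.1) (SecRing Φ V.1)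
  compat : ∀ (V V' : X.affineOpens) (hV : V.1 ≤ W) (hV' : V'.1 ≤ V.1) (a : SecRing Φ V.1),
    secRes Φ hV' (der V hV a) = der V' (hV'.trans hV) (secRes Φ hV' a)

/-- The ideal of a point in the ring of functions of an affine open neighbourhood. -/
noncomputable def pointIdeal (V : X.affineOpens) (p : X) (hp : p ∈ V.1) : Ideal (SecRing Φ V.1) :=
  (V.2.primeIdealOf ⟨p, hp⟩).asIdeal

end

section

variable {k : ℕ} (Φ : X ⟶ Spec (polyRing K (k + 2)))

/-- The standard coordinate functions on `V`. -/
noncomputable def chartCoord (V : X.Opens) (i : Fin (k + 2)) : SecRing Φ V :=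
  coordElt K (SecRing Φ V) (k + 2) i

/-- The special basis on the affine open set `V`. -/
noncomputable def algG [Etale Φ] (I : Finset ℕ) (V : X.affineOpens) (i : ℕ) :
    Derivation K (SecRing Φ V.1) (SecRing Φ V.1) :=
  spG k I (chartCoord Φ V.1) (coordDer K (SecRing Φ V.1) (k + 2)) i

/-- `z` is a section of the sheaf `Δ_i` of the Lie square sequence, i.e., it is locally obtained by
forming sums of Lie brackets. -/
def IsLieSquareSection (I : Finset ℕ) (i : ℕ) {W : X.Opens} (z : VectorFieldOn Φ W) : Prop :=
  ∀ q ∈ W, ∃ (V : X.affineOpens) (hV : V.1 ≤ W), q ∈ V.1 ∧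
    z.der V hV ∈ lieSquareModule (K := K) I (chartCoord Φ V.1) i

/-- `z` is a section of the sheaf `Δ^h` of the small growth sequence, i.e., it is locally obtained by
forming sums of Lie brackets. -/
def IsSmallGrowthSection (I : Finset ℕ) (h : ℕ) {W : X.Opens} (z : VectorFieldOn Φ W) : Prop :=
  ∀ q ∈ W, ∃ (V : X.affineOpens) (hV : V.1 ≤ W), q ∈ V.1 ∧
    z.der V hV ∈ smallGrowthModule (K := K) I (chartCoord Φ V.1) h

end

end Schemes

end Monster

namespace Monster

/-! ### Positions of the standard coordinates -/

section Indices

/-! Write ω_j for the form d(d_j) − n_j d(r_j). Up to sign, ω_1, …, ω_k are dual to g_{k+1}, …, g_2: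
ω_j takes the value ±1 on g_{k+2−j} and 0 on every other g_i (`omega_spG`), and the common kernel of
the ω_j is spanned by g_0 and g_1 (`eq_of_omega_eq_zero`). So the coefficient of g_i in z is
±ω_{k+2−i}(z), and the question is how these contractions change under brackets. For a focal field a
and j < k, one has ω_j([a,b]) = a(ω_j(b)) ± a(r_{j+1}) ω_{j+1}(b) (`omega_bracket_of_focal`), and
a(r_{j+1}) is a multiple of the product of the n_h with h ∈ I, h > j+1 (`focal_retIdx`). Hence each
bracket with Δ reaches at most one further g_i; the new coefficient of g_{i+1} is a derivative of
the old one, which may cost one order, plus the old coefficient of g_i times that product, which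
gains the orders of the n_h. The numbers e_{hi} satisfy exactly the inequalities that this requires
(`GrowthBound.bracket`).

The induction does not use focal orders but word orders (`WordOrd`): all words of length less than m
in g_0, g_1 applied to f vanish at p. Word orders obey the Leibniz estimates and drop by at most one
under a focal field; a word order at least m forces a focal order at least m, since differentiation
along a focal curve is a combination of g_0 and g_1.

The opposite comparison is needed only for the n_j. Let μ_j be the order of n_j (for j ∈ I) along a
polynomial integral curve of g_0 + g_1 through p (`exists_generic_curve`). Then VO_j ≤ μ_j, as the
focal order is an infimum, and n_j has word order at least μ_j (`wordOrd_newIdx`): any focal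
derivative of n_j is a multiple of a fixed monomial in later coordinates, and along the curve the
order of n_j, when it vanishes at p, is exactly one more than that of the monomial. So e_{hi}(VO) ≤
e_{hi}(μ) ≤ word order of c_{hi} ≤ focal order of c_{hi}.

What is left after removing the terms with i ≥ 4 is killed by ω_j for j < k−1, and two explicit
brackets with g_0 put any such field in Δ_3. The bracket and order estimates are carried out for
derivations of a commutative ring, and then applied to germs at p and to rings of functions with
étale coordinates. -/

theorem newIdx_val {k j : ℕ} (hj : j ≤ k) : (newIdx k j : ℕ) = j + 1 :=
  Nat.mod_eq_of_lt (by omega)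

theorem newIdx_inj {k a b : ℕ} (ha : a ≤ k) (hb : b ≤ k) : newIdx k a = newIdx k b ↔ a = b := by
  rw [Fin.ext_iff, newIdx_val ha, newIdx_val hb]; omega

theorem newIdx_ne_zero {k j : ℕ} (hj : j ≤ k) : newIdx k j ≠ 0 := by
  intro h
  have := newIdx_val hj
  rw [h] at this
  simp at this

theorem retIdx_eq (k : ℕ) (I : Finset ℕ) (j : ℕ) :
    retIdx k I j = 0 ∨ ∃ m < j, m + 1 ∈ I ∧ retIdx k I j = newIdx k m := by
  induction j with
  | zero => exact Or.inl rfl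
  | succ j ih =>
    by_cases h : j + 1 ∈ I
    · exact Or.inr ⟨j, by omega, h, by simp [retIdx, h]⟩
    · simp only [retIdx, h, if_false]
      rcases ih with h0 | ⟨m, hm, hI, he⟩
      · exact Or.inl h0
      · exact Or.inr ⟨m, by omega, hI, he⟩

theorem retIdx_ne_newIdx {k : ℕ} {I : Finset ℕ} {j l : ℕ} (hj : j ≤ k + 1) (hl : l ≤ k)
    (h : j ≤ l ∨ l + 1 ∉ I) : retIdx k I j ≠ newIdx k l := by
  intro he
  rcases retIdx_eq k I j with h0 | ⟨m, hm, hI, hm'⟩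
  · exact newIdx_ne_zero hl (he.symm.trans h0)
  · rw [he, newIdx_inj hl (by omega)] at hm'
    subst hm'
    rcases h with h | h
    · omega
    · exact h hI

/-- The inversion at l+1 retains n_l, and each later inversion replaces the retained coordinate by a
newer one. Thus it stays among the n_m with m ≥ l, along which f_l has no component. -/
theorem retIdx_eq_newIdx {k : ℕ} {I : Finset ℕ} {j l : ℕ} (hl : l + 1 ∈ I) (h : l < j) :
    ∃ m, l ≤ m ∧ m < j ∧ retIdx k I j = newIdx k m := by
  induction j with
  | zero => omega
  | succ j ih =>
    by_cases hj : j + 1 ∈ I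
    · exact ⟨j, by omega, by omega, by simp [retIdx, hj]⟩
    · have : l ≠ j := by rintro rfl; exact hj hl
      obtain ⟨m, h1, h2, h3⟩ := ih (by omega)
      exact ⟨m, h1, by omega, by simp [retIdx, hj, h3]⟩

end Indices

/-! ### Functoriality of the special basis -/

section Naturality

variable {B M B' M' : Type*} [CommRing B] [AddCommGroup M] [Module B M]
  [CommRing B'] [AddCommGroup M'] [Module B' M']

/-- The recursion uses only sums and scalar multiples. This is applied to evaluation at a point, to
taking components of derivations, and to algebra homomorphisms. -/
theorem map_stdF (σ : B →+* B') (φ : M →+ M') (hφ : ∀ b m, φ (b • m) = σ b • φ m) (k : ℕ)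
    (I : Finset ℕ) (x : Fin (k + 2) → B) (pd : Fin (k + 2) → M) (j : ℕ) :
    φ (stdF k I x pd j) = stdF k I (fun i => σ (x i)) (fun i => φ (pd i)) j := by
  induction j with
  | zero => rfl
  | succ j ih => simp only [stdF, stdV]; split_ifs <;> simp [hφ, ih]

theorem map_spG (σ : B →+* B') (φ : M →+ M') (hφ : ∀ b m, φ (b • m) = σ b • φ m) (k : ℕ)
    (I : Finset ℕ) (x : Fin (k + 2) → B) (pd : Fin (k + 2) → M) (i : ℕ) :
    φ (spG k I x pd i) = spG k I (fun i => σ (x i)) (fun i => φ (pd i)) i := by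
  rcases i with _ | _ | i
  · exact map_stdF σ φ hφ k I x pd k
  · rfl
  · simp only [spG]
    split_ifs
    · rw [map_zsmul, map_stdF σ φ hφ]
    · rw [map_zsmul]; rfl

end Naturality

/-! ### Duality between the focal forms and the special basis -/

section Tuples

variable {B : Type*} [CommRing B] {k : ℕ} {I : Finset ℕ}

/-- The contraction of the form `d d_j - n_j d r_j` with the vector field with components `z`. -/
def omega (I : Finset ℕ) (x z : Fin (k + 2) → B) (j : ℕ) : B :=
  z (deactIdx k I j) - x (newIdx k j) * z (retIdx k I j)

theorem omega_add (x z w : Fin (k + 2) → B) (j : ℕ) :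
    omega I x (z + w) j = omega I x z j + omega I x w j := by
  simp [omega]; ring

theorem omega_sub (x z w : Fin (k + 2) → B) (j : ℕ) :
    omega I x (z - w) j = omega I x z j - omega I x w j := by
  simp [omega]; ring

theorem omega_smul (x : Fin (k + 2) → B) (b : B) (z : Fin (k + 2) → B) (j : ℕ) :
    omega I x (b • z) j = b * omega I x z j := by
  simp [omega]; ring

theorem omega_zsmul (x : Fin (k + 2) → B) (b : ℤ) (z : Fin (k + 2) → B) (j : ℕ) :
    omega I x (b • z) j = b * omega I x z j := by
  simp [omega]; ring

theorem omega_zero (x : Fin (k + 2) → B) (j : ℕ) : omega I x 0 j = 0 := by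
  simp [omega]

theorem omega_sum {ι : Type*} (x : Fin (k + 2) → B) (s : Finset ι) (z : ι → Fin (k + 2) → B)
    (j : ℕ) : omega I x (∑ i ∈ s, z i) j = ∑ i ∈ s, omega I x (z i) j := by
  classical
  induction s using Finset.induction_on with
  | empty => simp [omega_zero]
  | insert a s ha ih => rw [Finset.sum_insert ha, Finset.sum_insert ha, omega_add, ih]

theorem map_omega {B' : Type*} [CommRing B'] (σ : B →+* B') (x z : Fin (k + 2) → B) (j : ℕ) :
    σ (omega I x z j) = omega I (fun i => σ (x i)) (fun i => σ (z i)) j := by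
  simp [omega]

/-- The coordinate vector fields, as tuples of components. -/
def stdPd (B : Type*) [CommRing B] (k : ℕ) (i : Fin (k + 2)) : Fin (k + 2) → B := Pi.single i 1

theorem stdV_newIdx {l m : ℕ} (hl : l ≤ k) (hm : m ≤ k) :
    stdV k (stdPd B k) l (newIdx k m) = if m = l then 1 else 0 := by
  simp [stdV, stdPd, Pi.single_apply, newIdx_inj hm hl]

theorem stdV_retIdx {l j : ℕ} (hl : l ≤ k) (hj : j ≤ k + 1) (h : j ≤ l ∨ l + 1 ∉ I) :
    stdV k (stdPd B k) l (retIdx k I j) = 0 := by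
  simp [stdV, stdPd, retIdx_ne_newIdx hj hl h]

/-- The last hypothesis keeps n_l from being a retained coordinate at stage j, so its differential
can enter the form only as that of the deactivated coordinate, which happens for j = l+1. -/
theorem omega_stdV {x : Fin (k + 2) → B} {l j : ℕ} (hl : l ≤ k) (h1 : 1 ≤ j) (hj : j ≤ k)
    (h : j ≤ l ∨ l + 1 ∉ I) :
    omega I x (stdV k (stdPd B k) l) j = if j = l + 1 then 1 else 0 := by
  obtain ⟨j, rfl⟩ : ∃ i, j = i + 1 := ⟨j - 1, by omega⟩
  have hr : stdV k (stdPd B k) l (retIdx k I (j + 1)) = 0 := stdV_retIdx hl (by omega) h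
  rw [omega, hr, mul_zero, sub_zero, deactIdx]
  split_ifs with hI hjl hjl
  · rcases h with h | h
    · omega
    · rw [Nat.succ.inj hjl] at hI; exact absurd hI h
  · exact stdV_retIdx hl (by omega) (h.imp (by omega) id)
  · rw [stdV_newIdx hl (by omega), if_pos (by omega)]
  · rw [stdV_newIdx hl (by omega), if_neg (by omega)]

theorem stdF_newIdx (x : Fin (k + 2) → B) {l m : ℕ} (hlm : l ≤ m) (hm : m ≤ k) :
    stdF k I x (stdPd B k) l (newIdx k m) = 0 := by
  induction l with
  | zero => simp [stdF, stdPd, newIdx_ne_zero hm]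
  | succ l ih =>
    have hv : stdV k (stdPd B k) l (newIdx k m) = 0 := by
      rw [stdV_newIdx (by omega) hm, if_neg (by omega)]
    simp only [stdF]
    split_ifs <;> simp [ih (by omega), hv]

theorem stdF_retIdx (x : Fin (k + 2) → B) {l : ℕ} (hl : l ≤ k) :
    stdF k I x (stdPd B k) l (retIdx k I l) = 1 := by
  induction l with
  | zero => simp [stdF, stdPd, retIdx]
  | succ l ih =>
    by_cases h : l + 1 ∈ I
    · simp [stdF, retIdx, h, stdF_newIdx x le_rfl (by omega : l ≤ k),
        stdV_newIdx (B := B) (by omega : l ≤ k) (by omega : l ≤ k)]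
    · simp [stdF, retIdx, h, ih (by omega),
        stdV_retIdx (B := B) (by omega : l ≤ k) (by omega : l ≤ k + 1) (Or.inr h)]

/-- The step from f_l to f_{l+1} is made so that form l+1 vanishes; the earlier forms do not see the
added multiple of v_l. -/
theorem omega_stdF (x : Fin (k + 2) → B) {l j : ℕ} (hl : l ≤ k) (h1 : 1 ≤ j) (hj : j ≤ l) :
    omega I x (stdF k I x (stdPd B k) l) j = 0 := by
  induction l with
  | zero => omega
  | succ l ih =>
    rcases Nat.lt_or_ge j (l + 1) with hlt | hge
    · have hv := omega_stdV (I := I) (x := x) (by omega : l ≤ k) h1 (by omega)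
        (Or.inl (by omega : j ≤ l))
      rw [if_neg (by omega)] at hv
      simp only [stdF]
      split_ifs <;> simp [omega_add, omega_smul, ih (by omega) (by omega), hv]
    · obtain rfl : j = l + 1 := by omega
      rw [omega, stdF_retIdx x hl, mul_one, deactIdx]
      have e1 := stdF_newIdx (I := I) x le_rfl (by omega : l ≤ k)
      have e2 := stdF_retIdx (I := I) x (by omega : l ≤ k)
      have e3 := stdV_newIdx (B := B) (by omega : l ≤ k) (by omega : l ≤ k)
      have e4 := stdV_retIdx (I := I) (B := B) (by omega : l ≤ k) (by omega : l ≤ k + 1)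
        (Or.inl le_rfl)
      by_cases h : l + 1 ∈ I <;> simp [stdF, h, e1, e2, e3, e4]

/-- As l+1 is inverted, r_l is deactivated there, and f_l has component 1 along it. The coordinates
in later forms are n_m with m ≥ l, where f_l has component 0. -/
theorem omega_stdF_of_mem (x : Fin (k + 2) → B) {l j : ℕ} (hl : l + 1 ∈ I) (h1 : 1 ≤ j)
    (hj : j ≤ k) (hlk : l ≤ k) :
    omega I x (stdF k I x (stdPd B k) l) j = if j = l + 1 then 1 else 0 := by
  split_ifs with h
  · subst h
    simp [omega, deactIdx, retIdx, hl, stdF_retIdx (I := I) x hlk,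
      stdF_newIdx (I := I) x le_rfl hlk]
  · rcases Nat.lt_or_ge l j with hlt | hge
    · have key : ∀ i, l < i → i ≤ k → stdF k I x (stdPd B k) l (retIdx k I i) = 0 := by
        intro i hi hik
        obtain ⟨m, h1, h2, h3⟩ := retIdx_eq_newIdx (k := k) hl hi
        rw [h3, stdF_newIdx x h1 (by omega)]
      obtain ⟨j, rfl⟩ : ∃ i, j = i + 1 := ⟨j - 1, by omega⟩
      rw [omega, key _ hlt hj, mul_zero, sub_zero, deactIdx]
      split_ifs
      · exact key _ (by omega) (by omega)
      · exact stdF_newIdx x (by omega) (by omega)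
    · exact omega_stdF x hlk h1 hge

/-- Of v and f at level k−i+1, the field g_i is, up to sign, the one pointing along the coordinate
deactivated at position k−i+2. This duality lets coefficients be read off by contraction. -/
theorem omega_spG (x : Fin (k + 2) → B) {i j : ℕ} (hi : 2 ≤ i)
    (hik : i ≤ k + 1) (h1 : 1 ≤ j) (hj : j ≤ k) :
    omega I x (spG k I x (stdPd B k) i) j = if j = k + 2 - i then (spSign k I i : B) else 0 := by
  obtain ⟨i, rfl⟩ : ∃ l, i = l + 2 := ⟨i - 2, by omega⟩
  obtain ⟨l, hl⟩ : ∃ l, k = l + 1 + i := ⟨k - 1 - i, by omega⟩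
  have e1 : k + 2 - (i + 2) = l + 1 := by omega
  have e2 : k + 1 - (i + 2) = l := by omega
  simp only [spG, e1, e2]
  split_ifs with h hj' hj'
  · rw [omega_zsmul, omega_stdF_of_mem x h h1 hj (by omega), if_pos hj', mul_one]
  · rw [omega_zsmul, omega_stdF_of_mem x h h1 hj (by omega), if_neg hj', mul_zero]
  · rw [omega_zsmul, omega_stdV (by omega) h1 hj (Or.inr h), if_pos hj', mul_one]
  · rw [omega_zsmul, omega_stdV (by omega) h1 hj (Or.inr h), if_neg hj', mul_zero]

theorem spSign_mul_self (k : ℕ) (I : Finset ℕ) (i : ℕ) : spSign k I i * spSign k I i = 1 := by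
  induction i using Nat.strong_induction_on with
  | _ i ih =>
    rcases i with _ | _ | i
    · rfl
    · rfl
    · simp only [spSign]
      split_ifs
      · exact ih _ (by omega)
      · rw [neg_mul_neg]; exact ih _ (by omega)

/-- Each form expresses the component along d_j through the one along r_j, so only the components
along the active coordinates r_j and n_j remain free. -/
theorem eq_of_omega_eq_zero_aux {x z : Fin (k + 2) → B} {j : ℕ} (hj : j ≤ k)
    (hz : ∀ i, 1 ≤ i → i ≤ j → omega I x z i = 0) {i : Fin (k + 2)} (hi : (i : ℕ) ≤ j + 1) :
    z i = z (retIdx k I j) * stdF k I x (stdPd B k) j i +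
      z (newIdx k j) * stdV k (stdPd B k) j i := by
  induction j with
  | zero =>
    simp only [stdF, stdV, stdPd, retIdx, Pi.single_apply]
    rcases Nat.eq_zero_or_pos (i : ℕ) with h0 | h0
    · have : i = 0 := Fin.ext h0
      subst this
      simp [(newIdx_ne_zero hj).symm]
    · have : i = newIdx k 0 := Fin.ext (by rw [newIdx_val hj]; omega)
      subst this
      simp [newIdx_ne_zero hj]
  | succ j ih =>
    have hz' := hz (j + 1) (by omega) le_rfl
    rw [omega, sub_eq_zero, deactIdx] at hz'
    by_cases hi' : i = newIdx k (j + 1)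
    · subst hi'
      rw [stdF_newIdx x le_rfl hj, stdV_newIdx hj hj]; simp
    · have hv : stdV k (stdPd B k) (j + 1) i = 0 := by simp [stdV, stdPd, hi']
      have hlt : (i : ℕ) ≤ j + 1 := by
        have : (i : ℕ) ≠ j + 2 := fun h => hi' (Fin.ext (by rw [newIdx_val hj, h]))
        omega
      rw [hv, mul_zero, add_zero, ih (by omega) (fun i h1 h2 => hz i h1 (by omega)) hlt]
      by_cases h : j + 1 ∈ I
      · simp only [h, if_true, retIdx, stdF, Pi.add_apply, Pi.smul_apply, smul_eq_mul] at hz' ⊢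
        rw [hz']; ring
      · simp only [h, if_false, retIdx, stdF, Pi.add_apply, Pi.smul_apply, smul_eq_mul] at hz' ⊢
        rw [hz']; ring

/-- A focal vector field is a combination of `g_0` and `g_1`. -/
theorem eq_of_omega_eq_zero {x z : Fin (k + 2) → B}
    (hz : ∀ i, 1 ≤ i → i ≤ k → omega I x z i = 0) :
    z = z (retIdx k I k) • spG k I x (stdPd B k) 0 + z (newIdx k k) • spG k I x (stdPd B k) 1 :=
  funext fun i => eq_of_omega_eq_zero_aux le_rfl hz (Nat.lt_succ_iff.mp i.2)

theorem focal_iff {x z : Fin (k + 2) → B} :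
    (∀ j ∈ Finset.Icc 1 k, z (deactIdx k I j) = x (newIdx k j) * z (retIdx k I j)) ↔
      ∀ i, 1 ≤ i → i ≤ k → omega I x z i = 0 := by
  simp [omega, sub_eq_zero]

theorem omega_spG_zero (x : Fin (k + 2) → B) {j : ℕ} (h1 : 1 ≤ j) (hj : j ≤ k) :
    omega I x (spG k I x (stdPd B k) 0) j = 0 :=
  omega_stdF x le_rfl h1 hj

theorem omega_spG_one (x : Fin (k + 2) → B) {j : ℕ} (h1 : 1 ≤ j) (hj : j ≤ k) :
    omega I x (spG k I x (stdPd B k) 1) j = 0 := by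
  have := omega_stdV (I := I) (x := x) le_rfl h1 hj (Or.inl hj)
  rwa [if_neg (by omega)] at this

theorem spG_zero_retIdx (x : Fin (k + 2) → B) :
    spG k I x (stdPd B k) 0 (retIdx k I k) = 1 := stdF_retIdx x le_rfl

theorem spG_zero_newIdx (x : Fin (k + 2) → B) :
    spG k I x (stdPd B k) 0 (newIdx k k) = 0 := stdF_newIdx x le_rfl le_rfl

theorem spG_one_newIdx (x : Fin (k + 2) → B) :
    spG k I x (stdPd B k) 1 (newIdx k k) = 1 := by
  have := stdV_newIdx (B := B) (le_refl k) (le_refl k)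
  rwa [if_pos rfl] at this

end Tuples

/-! ### Components of focal fields as monomials -/

section TailProd

variable {B : Type*} [CommRing B] {k : ℕ} {I : Finset ℕ}

/-- The product of the `n_h` with `h ∈ I` and `j < h ≤ k`. -/
def tailProd (k : ℕ) (I : Finset ℕ) (N : ℕ → B) (j : ℕ) : B :=
  ∏ h ∈ Finset.Ioc j k, if h ∈ I then N h else 1

theorem tailProd_self (N : ℕ → B) : tailProd k I N k = 1 := by simp [tailProd]

theorem tailProd_of_lt (N : ℕ → B) {j : ℕ} (hj : j < k) :
    tailProd k I N j = (if j + 1 ∈ I then N (j + 1) else 1) * tailProd k I N (j + 1) := by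
  rw [tailProd, tailProd, ← Finset.insert_Ioc_add_one_left_eq_Ioc hj,
    Finset.prod_insert (by simp)]

/-- Descend from r_k: at an inverted position j+1, r_j is d_{j+1} and picks up the factor n_{j+1};
otherwise r_j and r_{j+1} are the same coordinate. -/
theorem focal_retIdx {x z : Fin (k + 2) → B} (hz : ∀ i, 1 ≤ i → i ≤ k → omega I x z i = 0)
    {j : ℕ} (hj : j ≤ k) :
    z (retIdx k I j) = tailProd k I (fun h => x (newIdx k h)) j * z (retIdx k I k) := by
  induction hj using Nat.decreasingInduction with
  | self => simp [tailProd_self]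
  | of_succ j hj ih =>
    have h := hz (j + 1) (by omega) hj
    rw [omega, sub_eq_zero, deactIdx] at h
    rw [tailProd_of_lt _ hj, mul_assoc, ← ih]
    by_cases hI : j + 1 ∈ I
    · simpa [hI] using h
    · simp [hI, retIdx]

theorem focal_newIdx {x z : Fin (k + 2) → B} (hz : ∀ i, 1 ≤ i → i ≤ k → omega I x z i = 0)
    {j : ℕ} (hj : j < k) :
    z (newIdx k j) = (if j + 1 ∈ I then 1 else x (newIdx k (j + 1))) * z (retIdx k I (j + 1)) := by
  have h := hz (j + 1) (by omega) hj
  rw [omega, sub_eq_zero, deactIdx] at h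
  by_cases hI : j + 1 ∈ I
  · simp [hI, retIdx]
  · simpa [hI] using h

end TailProd

/-! ### Contractions of Lie brackets -/

section Bracket

variable {R B : Type*} [CommRing R] [CommRing B] [Algebra R B] {k : ℕ} {I : Finset ℕ}

/-- Cartan's formula for ω_j, whose exterior derivative is −dn_j ∧ dr_j. -/
theorem omega_bracket (a b : Derivation R B B) (x : Fin (k + 2) → B) (j : ℕ) :
    omega I x (fun i => a (b (x i)) - b (a (x i))) j =
      a (omega I x (fun i => b (x i)) j) - b (omega I x (fun i => a (x i)) j) +
        (a (x (newIdx k j)) * b (x (retIdx k I j)) -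
          b (x (newIdx k j)) * a (x (retIdx k I j))) := by
  simp [omega]; ring

/-- The contractions of the bracket of a focal vector field with an arbitrary one. -/
theorem omega_bracket_of_focal (a b : Derivation R B B) (x : Fin (k + 2) → B)
    (ha : ∀ i, 1 ≤ i → i ≤ k → omega I x (fun i => a (x i)) i = 0) {j : ℕ} (h1 : 1 ≤ j)
    (hj : j < k) :
    omega I x (fun i => a (b (x i)) - b (a (x i))) j =
      a (omega I x (fun i => b (x i)) j) +
        (if j + 1 ∈ I then 1 else -1) *
          (a (x (retIdx k I (j + 1))) * omega I x (fun i => b (x i)) (j + 1)) := by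
  rw [omega_bracket, ha j h1 hj.le, map_zero, sub_zero]
  -- The coordinates n_j, r_j are d_{j+1}, r_{j+1} in one order or the other; substituting
  -- a(d_{j+1}) = n_{j+1} a(r_{j+1}) leaves a(r_{j+1}) ω_{j+1}(b), with a sign given by that order.
  congr 1
  have h := ha (j + 1) (by omega) hj
  simp only [omega, deactIdx, retIdx] at h ⊢
  split_ifs at h ⊢ with hI
  · rw [sub_eq_zero] at h
    rw [h]; ring
  · rw [sub_eq_zero] at h
    rw [h]; ring

theorem omega_bracket_of_focal_self (a b : Derivation R B B) (x : Fin (k + 2) → B)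
    (ha : ∀ i, 1 ≤ i → i ≤ k → omega I x (fun i => a (x i)) i = 0)
    (hb : ∀ i, 1 ≤ i → i ≤ k → omega I x (fun i => b (x i)) i = 0) (hk : 1 ≤ k)
    (har : a (x (retIdx k I k)) = 1) (han : a (x (newIdx k k)) = 0) :
    omega I x (fun i => a (b (x i)) - b (a (x i))) k = -b (x (newIdx k k)) := by
  rw [omega_bracket, ha k hk le_rfl, hb k hk le_rfl, har, han]
  simp

end Bracket

end Monster

namespace Monster

/-! ### Word orders with respect to a set of derivations -/

section WordOrder

variable {R B : Type*} [CommRing R] [CommRing B] [Algebra R B]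

/-- All words of length less than `m` in the derivations of `S` send `f` into the ideal `𝔪`. -/
def WordOrd (S : Set (Derivation R B B)) (𝔪 : Ideal B) : ℕ → B → Prop
  | 0, _ => True
  | m + 1, f => f ∈ 𝔪 ∧ ∀ a ∈ S, WordOrd S 𝔪 m (a f)

variable {S : Set (Derivation R B B)} {𝔪 : Ideal B}

namespace WordOrd

theorem of_succ {m : ℕ} {f : B} (h : WordOrd S 𝔪 (m + 1) f) : WordOrd S 𝔪 m f := by
  induction m generalizing f with
  | zero => trivial
  | succ m ih => exact ⟨h.1, fun a ha => ih (h.2 a ha)⟩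

theorem mono {m n : ℕ} {f : B} (h : WordOrd S 𝔪 n f) (hmn : m ≤ n) : WordOrd S 𝔪 m f := by
  induction n, hmn using Nat.le_induction with
  | base => exact h
  | succ n _ ih => exact ih h.of_succ

theorem zero (m : ℕ) : WordOrd S 𝔪 m 0 := by
  induction m with
  | zero => trivial
  | succ m ih => exact ⟨zero_mem _, fun a _ => by simpa using ih⟩

theorem add {m : ℕ} {f g : B} (hf : WordOrd S 𝔪 m f) (hg : WordOrd S 𝔪 m g) :
    WordOrd S 𝔪 m (f + g) := by
  induction m generalizing f g with
  | zero => trivial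
  | succ m ih =>
    exact ⟨add_mem hf.1 hg.1, fun a ha => by simpa using ih (hf.2 a ha) (hg.2 a ha)⟩

/-- By the Leibniz rule, each term of the derivative of a product charges one unit to a single
factor. An inequality for N is kept because a factor of order 0 has nothing to lose. -/
theorem mul_aux (N : ℕ) : ∀ m n : ℕ, N ≤ m + n → ∀ f g : B, WordOrd S 𝔪 m f →
    WordOrd S 𝔪 n g → WordOrd S 𝔪 N (f * g) := by
  induction N with
  | zero => intros; trivial
  | succ N ih =>
    intro m n hN f g hf hg
    refine ⟨?_, fun a ha => ?_⟩
    · rcases m with _ | m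
      · rcases n with _ | n
        · omega
        · exact Ideal.mul_mem_left _ _ hg.1
      · exact Ideal.mul_mem_right _ _ hf.1
    · rw [a.leibniz]
      refine add ?_ ?_
      · rcases n with _ | n
        · exact ih m 0 (by omega) _ _ hf trivial
        · exact ih m n (by omega) _ _ hf (hg.2 a ha)
      · rcases m with _ | m
        · exact ih n 0 (by omega) _ _ hg trivial
        · exact ih n m (by omega) _ _ hg (hf.2 a ha)

theorem mul {m n : ℕ} {f g : B} (hf : WordOrd S 𝔪 m f) (hg : WordOrd S 𝔪 n g) :
    WordOrd S 𝔪 (m + n) (f * g) := mul_aux _ m n le_rfl f g hf hg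

theorem mul_left {m : ℕ} {f : B} (b : B) (hf : WordOrd S 𝔪 m f) : WordOrd S 𝔪 m (b * f) :=
  mul_aux _ 0 m (by omega) b f trivial hf

theorem prod {ι : Type*} {s : Finset ι} {m : ι → ℕ} {f : ι → B}
    (h : ∀ i ∈ s, WordOrd S 𝔪 (m i) (f i)) : WordOrd S 𝔪 (∑ i ∈ s, m i) (∏ i ∈ s, f i) := by
  classical
  induction s using Finset.induction_on with
  | empty => trivial
  | insert a s ha ih =>
    rw [Finset.sum_insert ha, Finset.prod_insert ha]
    exact (h a (by simp)).mul (ih fun i hi => h i (by simp [hi]))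

theorem derivation {X Y a : Derivation R B B} {α β : B} (ha : a = α • X + β • Y) {m : ℕ} {f : B}
    (hf : WordOrd {X, Y} 𝔪 (m + 1) f) : WordOrd {X, Y} 𝔪 m (a f) := by
  rw [ha]
  exact ((hf.2 X (by simp)).mul_left α).add ((hf.2 Y (by simp)).mul_left β)

/-- Word orders are preserved and detected by a ring homomorphism that intertwines the two
derivations and detects membership in the two ideals. -/
theorem map_iff {R' B' : Type*} [CommRing R'] [CommRing B'] [Algebra R' B'] {𝔪' : Ideal B'}
    {X Y : Derivation R B B} {X' Y' : Derivation R' B' B'} (σ : B →+* B')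
    (hσ : ∀ f, σ f ∈ 𝔪' ↔ f ∈ 𝔪) (hX : ∀ f, σ (X f) = X' (σ f)) (hY : ∀ f, σ (Y f) = Y' (σ f))
    {m : ℕ} {f : B} : WordOrd {X', Y'} 𝔪' m (σ f) ↔ WordOrd {X, Y} 𝔪 m f := by
  induction m generalizing f with
  | zero => exact Iff.rfl
  | succ m ih => simp [WordOrd, hσ, ← hX, ← hY, ih]

end WordOrd

end WordOrder

/-! ### The recursion for the numbers e_{hi} -/

section GrowthBound

variable {R B : Type*} [CommRing R] [CommRing B] [Algebra R B] {k : ℕ} {I : Finset ℕ}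

/-- The number `e_{hi}` for finite vertical orders. -/
def eNat (k : ℕ) (μ : ℕ → ℕ) (h i : ℕ) : ℕ :=
  (∑ j ∈ Finset.Icc (k + 4 - i) k, (i + j - k - 3) * μ j) - (h - i)

theorem eNum_le_eNat {k : ℕ} {VO : ℕ → ℕ∞} {μ : ℕ → ℕ} (h i : ℕ)
    (hμ : ∀ j, 1 ≤ j → j ≤ k → VO j ≤ μ j) (hi : i ≤ k + 1) :
    eNum k VO h i ≤ (eNat k μ h i : ℕ) := by
  refine le_of_le_of_eq (tsub_le_tsub_right ?_ _) (ENat.natCast_sub _ _).symm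
  push_cast
  refine Finset.sum_le_sum fun j hj => ?_
  rw [Finset.mem_Icc] at hj
  gcongr
  exact hμ j (by omega) hj.2

theorem eNat_eq_zero (k : ℕ) (μ : ℕ → ℕ) (h : ℕ) {i : ℕ} (hi : i ≤ 3) : eNat k μ h i = 0 := by
  rw [eNat, Finset.Icc_eq_empty (by omega)]; simp

theorem eNat_succ_le (k : ℕ) (μ : ℕ → ℕ) {h i : ℕ} (hi : i ≤ h) :
    eNat k μ (h + 1) i ≤ eNat k μ h i - 1 := by
  simp only [eNat]; omega

/-- Raising h and i together keeps h − i and raises by one the weight of each μ_j with j > k+2−i;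
these j index the product that multiplies the coefficient of g_i in a bracket. -/
theorem eNat_succ_succ_le (k : ℕ) (μ : ℕ → ℕ) (h i : ℕ) (hi : i ≤ k) :
    eNat k μ (h + 1) (i + 1) ≤ (∑ j ∈ Finset.Ioc (k + 2 - i) k, μ j) + eNat k μ h i := by
  have key : (∑ j ∈ Finset.Icc (k + 4 - (i + 1)) k, (i + 1 + j - k - 3) * μ j) =
      (∑ j ∈ Finset.Ioc (k + 2 - i) k, μ j) +
        ∑ j ∈ Finset.Icc (k + 4 - i) k, (i + j - k - 3) * μ j := by
    have e1 : Finset.Icc (k + 4 - (i + 1)) k = Finset.Ioc (k + 2 - i) k := by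
      ext; simp only [Finset.mem_Icc, Finset.mem_Ioc]; omega
    have e2 : ∑ j ∈ Finset.Icc (k + 4 - i) k, (i + j - k - 3) * μ j =
        ∑ j ∈ Finset.Ioc (k + 2 - i) k, (i + j - k - 3) * μ j := by
      refine Finset.sum_subset (fun j => ?_) fun j hj hj' => ?_
      · simp only [Finset.mem_Icc, Finset.mem_Ioc]; omega
      · simp only [Finset.mem_Icc, Finset.mem_Ioc] at hj hj'
        rw [show i + j - k - 3 = 0 by omega, zero_mul]
    rw [e1, e2, ← Finset.sum_add_distrib]
    refine Finset.sum_congr rfl fun j hj => ?_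
    rw [Finset.mem_Ioc] at hj
    rw [show i + 1 + j - k - 3 = 1 + (i + j - k - 3) by omega]; ring
  simp only [eNat, key]; omega

/-- The coefficients of `z` with respect to the special basis satisfy the bounds asserted for a
section of `Δ^h`. -/
def GrowthBound (S : Set (Derivation R B B)) (𝔪 : Ideal B) (I : Finset ℕ) (x : Fin (k + 2) → B)
    (μ : ℕ → ℕ) (h : ℕ) (z : Fin (k + 2) → B) : Prop :=
  ∀ i, 2 ≤ i → i ≤ k + 1 → (h < i → omega I x z (k + 2 - i) = 0) ∧
    WordOrd S 𝔪 (eNat k μ h i) (omega I x z (k + 2 - i))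

variable {S : Set (Derivation R B B)} {𝔪 : Ideal B} {x : Fin (k + 2) → B} {μ : ℕ → ℕ} {h : ℕ}

namespace GrowthBound

theorem zero : GrowthBound S 𝔪 I x μ h 0 := fun i _ _ => by
  rw [omega_zero]; exact ⟨fun _ => rfl, WordOrd.zero _⟩

theorem add {z w : Fin (k + 2) → B} (hz : GrowthBound S 𝔪 I x μ h z)
    (hw : GrowthBound S 𝔪 I x μ h w) : GrowthBound S 𝔪 I x μ h (z + w) := fun i h1 h2 => by
  rw [omega_add]
  exact ⟨fun hi => by rw [(hz i h1 h2).1 hi, (hw i h1 h2).1 hi, add_zero],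
    (hz i h1 h2).2.add (hw i h1 h2).2⟩

theorem smul (b : B) {z : Fin (k + 2) → B} (hz : GrowthBound S 𝔪 I x μ h z) :
    GrowthBound S 𝔪 I x μ h (b • z) := fun i h1 h2 => by
  rw [omega_smul]
  exact ⟨fun hi => by rw [(hz i h1 h2).1 hi, mul_zero], (hz i h1 h2).2.mul_left b⟩

theorem sum {ι : Type*} {s : Finset ι} {z : ι → Fin (k + 2) → B}
    (hz : ∀ i ∈ s, GrowthBound S 𝔪 I x μ h (z i)) : GrowthBound S 𝔪 I x μ h (∑ i ∈ s, z i) := by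
  classical
  induction s using Finset.induction_on with
  | empty => simpa using zero
  | insert a s ha ih =>
    rw [Finset.sum_insert ha]
    exact (hz a (by simp)).add (ih fun i hi => hz i (by simp [hi]))

theorem succ {z : Fin (k + 2) → B} (hz : GrowthBound S 𝔪 I x μ h z) :
    GrowthBound S 𝔪 I x μ (h + 1) z := fun i h1 h2 =>
  ⟨fun hi => (hz i h1 h2).1 (by omega), (hz i h1 h2).2.mono (by simp only [eNat]; omega)⟩

theorem of_focal {z : Fin (k + 2) → B} (hz : ∀ i, 1 ≤ i → i ≤ k → omega I x z i = 0) :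
    GrowthBound S 𝔪 I x μ h z := fun i h1 h2 => by
  rw [hz _ (by omega) (by omega)]; exact ⟨fun _ => rfl, WordOrd.zero _⟩

/-- The coefficient of g_{i+1} in the bracket has two parts: the derivative of the old one, handled
by `eNat_succ_le`, and a monomial multiple of the old coefficient of g_i, handled by
`eNat_succ_succ_le`. -/
theorem bracket (hμ : ∀ j, 1 ≤ j → j ≤ k → WordOrd S 𝔪 (μ j) (if j ∈ I then x (newIdx k j) else 1))
    (a b : Derivation R B B)
    (haS : ∀ m f, WordOrd S 𝔪 (m + 1) f → WordOrd S 𝔪 m (a f))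
    (ha : ∀ i, 1 ≤ i → i ≤ k → omega I x (fun i => a (x i)) i = 0) (hh : 1 ≤ h)
    (hb : GrowthBound S 𝔪 I x μ h fun i => b (x i)) :
    GrowthBound S 𝔪 I x μ (h + 1) fun i => a (b (x i)) - b (a (x i)) := fun i h1 h2 => by
  -- For i = 2 the form is ω_k, outside the range of the bracket formula, but then the vanishing
  -- claim is vacuous and the bound is 0.
  rcases h1.eq_or_lt with rfl | h1
  · exact ⟨fun _ => by omega, by rw [eNat_eq_zero _ _ _ (by omega)]; trivial⟩
  obtain ⟨i, rfl⟩ : ∃ l, i = l + 1 := ⟨i - 1, by omega⟩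
  have e : k + 2 - (i + 1) + 1 = k + 2 - i := by omega
  rw [omega_bracket_of_focal a b x ha (by omega) (by omega), e]
  obtain ⟨hb0, hb1⟩ := hb i (by omega) (by omega)
  obtain ⟨hb0', hb1'⟩ := hb (i + 1) (by omega) h2
  refine ⟨fun hi => by rw [hb0 (by omega), hb0' (by omega)]; simp, WordOrd.add ?_ ?_⟩
  · rcases Nat.lt_or_ge h (i + 1) with hlt | hge
    · rw [hb0' hlt, map_zero]; exact WordOrd.zero _
    · have hle := eNat_succ_le k μ hge
      rcases Nat.eq_zero_or_pos (eNat k μ h (i + 1)) with h0 | h0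
      · rw [show eNat k μ (h + 1) (i + 1) = 0 by omega]; trivial
      · exact haS _ _ (hb1'.mono (by omega))
  · refine WordOrd.mul_left _ (WordOrd.mono ?_ (eNat_succ_succ_le k μ h i (by omega)))
    refine WordOrd.mul ?_ hb1
    rw [focal_retIdx (z := fun i => a (x i)) ha (by omega), mul_comm]
    refine WordOrd.mul_left _ (WordOrd.prod fun j hj => ?_)
    rw [Finset.mem_Ioc] at hj
    exact hμ j (by omega) hj.2

end GrowthBound

end GrowthBound

/-! ### A polynomial focal curve realizing the orders of the n_j -/

section GenericCurve

open Polynomial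

variable {K : Type*} [Field K] {k : ℕ} {I : Finset ℕ}

theorem exists_derivative_eq [CharZero K] (P : K[X]) (c : K) : ∃ Q : K[X], derivative Q = P ∧ Q.eval 0 = c := by
  have key : ∀ P : K[X], ∃ Q : K[X], derivative Q = P := by
    intro P
    induction P using Polynomial.induction_on' with
    | add p q hp hq =>
      obtain ⟨p', rfl⟩ := hp
      obtain ⟨q', rfl⟩ := hq
      exact ⟨p' + q', by simp⟩
    | monomial n a =>
      refine ⟨monomial (n + 1) (a / (n + 1)), ?_⟩
      have : (n : K) + 1 ≠ 0 := by exact_mod_cast n.succ_ne_zero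
      rw [derivative_monomial]
      simp [this]
  obtain ⟨Q, hQ⟩ := key P
  exact ⟨Q + C (c - Q.eval 0), by simp [hQ], by simp⟩

theorem tailProd_congr {B : Type*} [CommRing B] {N N' : ℕ → B} {j : ℕ}
    (h : ∀ i, j < i → i ≤ k → N i = N' i) : tailProd k I N j = tailProd k I N' j :=
  Finset.prod_congr rfl fun i hi => by
    rw [Finset.mem_Ioc] at hi
    rw [h i hi.1 hi.2]

/-- The equations of the integral curve are triangular: the derivative of n_j involves only n_i with
i > j, so they are solved by integrating from n_k down. -/
theorem exists_generic_sequence [CharZero K] (k : ℕ) (I : Finset ℕ) (p : ℕ → K) : ∃ N : ℕ → K[X],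
    derivative (N k) = 1 ∧
    (∀ j < k, derivative (N j) =
      (if j + 1 ∈ I then 1 else N (j + 1)) * tailProd k I N (j + 1)) ∧
    ∀ j ≤ k, (N j).eval 0 = p j := by
  suffices H : ∀ l ≤ k, ∃ N : ℕ → K[X], derivative (N k) = 1 ∧
      (∀ j < k, l ≤ j → derivative (N j) =
        (if j + 1 ∈ I then 1 else N (j + 1)) * tailProd k I N (j + 1)) ∧
      ∀ j ≤ k, l ≤ j → (N j).eval 0 = p j by
    obtain ⟨N, h1, h2, h3⟩ := H 0 (Nat.zero_le _)
    exact ⟨N, h1, fun j hj => h2 j hj (Nat.zero_le _), fun j hj => h3 j hj (Nat.zero_le _)⟩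
  intro l hl
  induction hl using Nat.decreasingInduction with
  | self =>
    refine ⟨fun _ => X + C (p k), by simp, fun j _ _ => by omega, fun j h1 h2 => ?_⟩
    obtain rfl : j = k := by omega
    simp
  | of_succ l hl ih =>
    obtain ⟨N, h1, h2, h3⟩ := ih
    obtain ⟨Q, hQ, hQ0⟩ := exists_derivative_eq
      ((if l + 1 ∈ I then 1 else N (l + 1)) * tailProd k I N (l + 1)) (p l)
    have hN : ∀ j, l < j → Function.update N l Q j = N j := fun j hj =>
      Function.update_of_ne (by omega) _ _
    have hT : ∀ j, l ≤ j →
        tailProd k I (Function.update N l Q) (j + 1) = tailProd k I N (j + 1) := fun j hj =>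
      tailProd_congr fun i hi _ => hN i (by omega)
    refine ⟨Function.update N l Q, by rw [hN k hl, h1], fun j hj hlj => ?_, fun j hj hlj => ?_⟩
    · rw [hT j hlj, hN (j + 1) (by omega)]
      rcases hlj.eq_or_lt with rfl | hlj
      · rw [Function.update_self, hQ]
      · rw [hN j hlj, h2 j hj hlj]
    · rcases hlj.eq_or_lt with rfl | hlj
      · rw [Function.update_self, hQ0]
      · rw [hN j hlj, h3 j hj hlj]

/-- An integral curve of the focal vector field `g_0 + g_1` with polynomial components. -/
theorem exists_generic_curve [CharZero K] (k : ℕ) (I : Finset ℕ) (p : Fin (k + 2) → K) :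
    ∃ q : Fin (k + 2) → K[X], (∀ i, (q i).eval 0 = p i) ∧
      (∀ j, 1 ≤ j → j ≤ k → omega I q (fun i => derivative (q i)) j = 0) ∧
      derivative (q (retIdx k I k)) = 1 ∧ derivative (q (newIdx k k)) = 1 := by
  obtain ⟨N, h1, h2, h3⟩ := exists_generic_sequence k I fun j => p (newIdx k j)
  obtain ⟨Q, hQ, hQ0⟩ := exists_derivative_eq (tailProd k I N 0) (p 0)
  let q : Fin (k + 2) → K[X] := fun i => if i = 0 then Q else N (i - 1)
  have hq0 : q 0 = Q := if_pos rfl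
  have hqn : ∀ j ≤ k, q (newIdx k j) = N j := fun j hj => by
    simp only [q, if_neg (newIdx_ne_zero hj), newIdx_val hj]; rfl
  have hret : ∀ j ≤ k, derivative (q (retIdx k I j)) = tailProd k I N j := by
    intro j hj
    induction j with
    | zero => rw [retIdx, hq0, hQ]
    | succ j ih =>
      have ht := tailProd_of_lt (I := I) N hj
      by_cases hI : j + 1 ∈ I
      · rw [retIdx, if_pos hI, hqn j (by omega), h2 j hj]; simp [hI]
      · rw [retIdx, if_neg hI, ih (by omega), ht]; simp [hI]
  refine ⟨q, fun i => ?_, fun j hj1 hj => ?_, by rw [hret k le_rfl, tailProd_self],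
    by rw [hqn k le_rfl, h1]⟩
  · rcases eq_or_ne i 0 with rfl | hi
    · rw [hq0, hQ0]
    · have : i = newIdx k (i - 1) := Fin.ext (by
        have : (i : ℕ) ≠ 0 := fun h => hi (Fin.ext h)
        rw [newIdx_val (by omega)]; omega)
      rw [this, hqn _ (by omega), h3 _ (by omega)]
  · obtain ⟨j, rfl⟩ : ∃ i, j = i + 1 := ⟨j - 1, by omega⟩
    rw [omega, sub_eq_zero, hret _ hj, hqn _ hj, deactIdx]
    split_ifs with hI
    · rw [hret j (by omega), tailProd_of_lt N hj, if_pos hI]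
    · rw [hqn j (by omega), h2 j hj, if_neg hI]

theorem rootMultiplicity_prod {ι : Type*} (s : Finset ι) (f : ι → K[X]) (hf : ∀ i ∈ s, f i ≠ 0)
    (a : K) : (∏ i ∈ s, f i).rootMultiplicity a = ∑ i ∈ s, (f i).rootMultiplicity a := by
  classical
  induction s using Finset.induction_on with
  | empty => simp
  | insert i s hi ih =>
    have h1 : f i ≠ 0 := hf i (by simp)
    have h2 : ∏ i ∈ s, f i ≠ 0 := Finset.prod_ne_zero_iff.mpr fun j hj => hf j (by simp [hj])
    rw [Finset.prod_insert hi, Finset.sum_insert hi, rootMultiplicity_mul (mul_ne_zero h1 h2),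
      ih fun j hj => hf j (by simp [hj])]

section

variable {q : Fin (k + 2) → K[X]}

theorem derivative_newIdx
    (hq : ∀ j, 1 ≤ j → j ≤ k → omega I q (fun i => derivative (q i)) j = 0)
    (hr : derivative (q (retIdx k I k)) = 1) {j : ℕ} (hj : j < k) :
    derivative (q (newIdx k j)) = (if j + 1 ∈ I then 1 else q (newIdx k (j + 1))) *
      tailProd k I (fun h => q (newIdx k h)) (j + 1) := by
  have h1 := focal_newIdx hq hj
  have h2 := focal_retIdx hq (Nat.succ_le_of_lt hj)
  rw [hr, mul_one] at h2
  rw [h1, h2]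

/-- The derivative of each n_j is 1 or a product of later n_i, hence nonzero by descending
induction. This makes the orders along the curve finite. -/
theorem newIdx_ne_zero_of_generic
    (hq : ∀ j, 1 ≤ j → j ≤ k → omega I q (fun i => derivative (q i)) j = 0)
    (hr : derivative (q (retIdx k I k)) = 1) (hn : derivative (q (newIdx k k)) = 1)
    {j : ℕ} (hj : j ≤ k) : ∀ i, j ≤ i → i ≤ k → q (newIdx k i) ≠ 0 := by
  induction hj using Nat.decreasingInduction with
  | self =>
    intro i h1 h2 h0
    obtain rfl : i = k := by omega
    rw [h0] at hn; simp at hn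
  | of_succ j hj ih =>
    intro i h1 h2
    rcases h1.eq_or_lt with rfl | h1
    · intro h0
      have h := derivative_newIdx hq hr hj
      rw [h0, derivative_zero, eq_comm, mul_eq_zero] at h
      rcases h with h | h
      · split_ifs at h
        · exact one_ne_zero h
        · exact ih _ le_rfl hj h
      · rw [tailProd, Finset.prod_eq_zero_iff] at h
        obtain ⟨l, hl, h⟩ := h
        rw [Finset.mem_Ioc] at hl
        split_ifs at h
        · exact ih l (by omega) hl.2 h
        · exact one_ne_zero h
    · exact ih i h1 h2

/-- The word order of `n_j` is at least its order along the generic curve. -/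
theorem wordOrd_newIdx [CharZero K] {R B : Type*} [CommRing R] [CommRing B] [Algebra R B]
    {S : Set (Derivation R B B)} {𝔪 : Ideal B} {x : Fin (k + 2) → B}
    (hS : ∀ a ∈ S, ∀ j, 1 ≤ j → j ≤ k → omega I x (fun i => a (x i)) j = 0)
    (hq : ∀ j, 1 ≤ j → j ≤ k → omega I q (fun i => derivative (q i)) j = 0)
    (hr : derivative (q (retIdx k I k)) = 1) (hn : derivative (q (newIdx k k)) = 1)
    (hx : ∀ i, (q i).eval 0 = 0 → x i ∈ 𝔪) {j : ℕ} (hj : j ≤ k) :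
    ∀ i, j ≤ i → i ≤ k →
      WordOrd S 𝔪 ((q (newIdx k i)).rootMultiplicity 0) (x (newIdx k i)) := by
  have hne := fun i hi => newIdx_ne_zero_of_generic hq hr hn (Nat.zero_le k) i (Nat.zero_le i) hi
  induction hj using Nat.decreasingInduction with
  | self =>
    intro i h1 h2
    have hik : i = k := by omega
    rw [hik]
    by_cases h0 : (q (newIdx k k)).eval 0 = 0
    -- The derivative of n_k along the curve is 1, so a zero of n_k at 0 is simple.
    · have h := derivative_rootMultiplicity_of_root (p := q (newIdx k k)) h0
      have h' : rootMultiplicity (0 : K) (1 : K[X]) = 0 := by simp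
      rw [hn, h'] at h
      exact WordOrd.mono (n := 1) ⟨hx _ h0, fun _ _ => trivial⟩ (by omega)
    · rw [rootMultiplicity_eq_zero h0]; trivial
  | of_succ j hj ih =>
    intro i h1 h2
    rcases h1.eq_or_lt with rfl | h1
    · by_cases h0 : (q (newIdx k j)).eval 0 = 0
      · have hpos := (rootMultiplicity_pos (hne j h2)).mpr h0
        -- In characteristic 0 the multiplicity of n_j is one more than that of its derivative,
        -- which is a product, so that its multiplicity is a sum over the factors.
        have h := derivative_rootMultiplicity_of_root (p := q (newIdx k j)) h0
        have hA : (if j + 1 ∈ I then 1 else q (newIdx k (j + 1))) ≠ 0 := by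
          split_ifs
          · exact one_ne_zero
          · exact hne _ hj
        have hB : ∀ l ∈ Finset.Ioc (j + 1) k, (if l ∈ I then q (newIdx k l) else 1) ≠ 0 := by
          intro l hl
          rw [Finset.mem_Ioc] at hl
          split_ifs
          · exact hne _ hl.2
          · exact one_ne_zero
        rw [derivative_newIdx hq hr hj, tailProd, rootMultiplicity_mul
          (mul_ne_zero hA (Finset.prod_ne_zero_iff.mpr hB)), rootMultiplicity_prod _ _ hB] at h
        refine WordOrd.mono (n := _ + 1) ⟨hx _ h0, fun a ha => ?_⟩
          (by rw [← Nat.sub_le_iff_le_add, ← h])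
        -- Every focal derivation sends n_j to a multiple of the same product, whose word order is
        -- at least that sum by induction.
        have e1 := focal_newIdx (hS a ha) hj
        have e2 := focal_retIdx (hS a ha) (Nat.succ_le_of_lt hj)
        rw [e1, e2, ← mul_assoc, mul_comm]
        refine WordOrd.mul_left _ (WordOrd.mul ?_ (WordOrd.prod fun l hl => ?_))
        · split_ifs
          · exact WordOrd.mono (n := 0) trivial (by simp)
          · exact ih _ le_rfl hj
        · rw [Finset.mem_Ioc] at hl
          split_ifs
          · exact ih l (by omega) hl.2
          · exact WordOrd.mono (n := 0) trivial (by simp)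
      · rw [rootMultiplicity_eq_zero h0]; trivial
    · exact ih i h1 h2

end

end GenericCurve

end Monster

namespace Monster

/-! ### Small growth and Lie square modules of derivations -/

section Modules

variable {K : Type*} [Field K] {B : Type*} [CommRing B] [Algebra K B] {k : ℕ} {I : Finset ℕ}
  {x : Fin (k + 2) → B}

theorem mem_focalModule {z : Derivation K B B} :
    z ∈ focalModule I x ↔ ∀ j, 1 ≤ j → j ≤ k → omega I x (fun i => z (x i)) j = 0 :=
  focal_iff (x := x) (z := fun i => z (x i))

theorem growthBound_of_mem_smallGrowthModule {S : Set (Derivation K B B)} {𝔪 : Ideal B}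
    {μ : ℕ → ℕ}
    (hμ : ∀ j, 1 ≤ j → j ≤ k → WordOrd S 𝔪 (μ j) (if j ∈ I then x (newIdx k j) else 1))
    (hS : ∀ a ∈ focalModule (K := K) I x, ∀ m f, WordOrd S 𝔪 (m + 1) f → WordOrd S 𝔪 m (a f))
    {h : ℕ} (hh : 1 ≤ h) {z : Derivation K B B} (hz : z ∈ smallGrowthModule I x h) :
    GrowthBound S 𝔪 I x μ h fun i => z (x i) := by
  induction h, hh using Nat.le_induction generalizing z with
  | base => exact GrowthBound.of_focal (mem_focalModule.mp hz)
  | succ h hh ih =>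
    obtain ⟨h, rfl⟩ : ∃ l, h = l + 1 := ⟨h - 1, by omega⟩
    obtain ⟨s, hs, t, ht, rfl⟩ := Submodule.mem_sup.mp hz
    refine GrowthBound.add (z := fun i => s (x i)) (w := fun i => t (x i)) ?_ (ih ht).succ
    clear hz
    induction hs using Submodule.span_induction with
    | mem s hs =>
      obtain ⟨a, ha, b, hb, rfl⟩ := hs
      exact GrowthBound.bracket hμ a b (hS a ha) (mem_focalModule.mp ha) hh (ih hb)
    | zero => exact GrowthBound.zero
    | add s s' _ _ hs hs' => exact hs.add hs'
    | smul b s _ hs => exact hs.smul b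

theorem bracket_add_mem {S T : Submodule B (Derivation K B B)}
    {a b c : Derivation K B B}
    (ha : a ∈ S) (hb : b ∈ T) (hc : c ∈ T) : ⁅a, b⁆ + c ∈ bracketModule S T :=
  Submodule.add_mem_sup (Submodule.subset_span ⟨a, ha, b, hb, rfl⟩) hc

variable {X Y : Derivation K B B}

theorem omega_sub_bracket (w a b : Derivation K B B) (j : ℕ) :
    omega I x (fun i => (w - ⁅a, b⁆) (x i)) j =
      omega I x (fun i => w (x i)) j - omega I x (fun i => a (b (x i)) - b (a (x i))) j :=
  omega_sub x (fun i => w (x i)) (fun i => a (b (x i)) - b (a (x i))) j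

/-- With c = ω_k(w), the bracket [X, −cY] has the same contractions as w, so the difference is
focal. -/
theorem mem_lieSquareModule_two (hX : X ∈ focalModule I x) (hY : Y ∈ focalModule I x)
    (hXr : X (x (retIdx k I k)) = 1) (hXn : X (x (newIdx k k)) = 0)
    (hYn : Y (x (newIdx k k)) = 1) {w : Derivation K B B}
    (hw : ∀ j, 1 ≤ j → j < k → omega I x (fun i => w (x i)) j = 0) :
    w ∈ lieSquareModule I x 2 := by
  set c := omega I x (fun i => w (x i)) k with hc
  have hb : (-c) • Y ∈ focalModule I x := Submodule.smul_mem _ _ hY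
  have key : w - ⁅X, (-c) • Y⁆ ∈ focalModule I x := by
    rw [mem_focalModule] at hX hb ⊢
    intro j h1 hj
    rw [omega_sub_bracket]
    rcases hj.eq_or_lt with rfl | hj
    · rw [omega_bracket_of_focal_self X _ x hX hb h1 hXr hXn, ← hc]
      simp [hYn]
    · rw [omega_bracket_of_focal X _ x hX h1 hj, hb j h1 hj.le, hb (j + 1) (by omega) hj, hw j h1 hj]
      simp
  have := bracket_add_mem (T := focalModule I x) hX hb key
  rwa [add_sub_cancel] at this

/-- The field [X, −Y] is detected by ω_k alone. Bracketing a multiple of it with X moves the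
coefficient to ω_{k−1}, where it can cancel that of w; the difference then lies in Δ_2. -/
theorem mem_lieSquareModule_three (hX : X ∈ focalModule I x) (hY : Y ∈ focalModule I x)
    (hXr : X (x (retIdx k I k)) = 1) (hXn : X (x (newIdx k k)) = 0)
    (hYn : Y (x (newIdx k k)) = 1) {w : Derivation K B B}
    (hw : ∀ j, 1 ≤ j → j + 1 < k → omega I x (fun i => w (x i)) j = 0) :
    w ∈ lieSquareModule I x 3 := by
  rcases Nat.lt_or_ge k 2 with hk | hk
  · exact Submodule.mem_sup_right
      (mem_lieSquareModule_two hX hY hXr hXn hYn fun j h1 hj => by omega)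
  have hX' := mem_focalModule.mp hX
  have hY' : ∀ j, 1 ≤ j → j ≤ k → omega I x (fun i => (-Y) (x i)) j = 0 :=
    mem_focalModule.mp (neg_mem hY)
  have huk : omega I x (fun i => ⁅X, -Y⁆ (x i)) k = 1 := by
    simp only [Derivation.commutator_apply]
    rw [omega_bracket_of_focal_self X (-Y) x hX' hY' (by omega) hXr hXn]
    simp [hYn]
  have hu : ∀ j, 1 ≤ j → j < k → omega I x (fun i => ⁅X, -Y⁆ (x i)) j = 0 := by
    intro j h1 hj
    simp only [Derivation.commutator_apply]
    rw [omega_bracket_of_focal X (-Y) x hX' h1 hj, hY' j h1 hj.le, hY' (j + 1) (by omega) hj]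
    simp
  -- The sign cancels the sign in `omega_bracket_of_focal` for j + 1 = k.
  set c : B := (if k ∈ I then 1 else -1) * omega I x (fun i => w (x i)) (k - 1) with hc
  have hbo : ∀ j, omega I x (fun i => (c • ⁅X, -Y⁆) (x i)) j =
      c * omega I x (fun i => ⁅X, -Y⁆ (x i)) j := fun j =>
    omega_smul x c (fun i => ⁅X, -Y⁆ (x i)) j
  have hb : c • ⁅X, -Y⁆ ∈ lieSquareModule I x 2 :=
    mem_lieSquareModule_two hX hY hXr hXn hYn fun j h1 hj => by rw [hbo, hu j h1 hj, mul_zero]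
  have key : w - ⁅X, c • ⁅X, -Y⁆⁆ ∈ lieSquareModule I x 2 := by
    refine mem_lieSquareModule_two hX hY hXr hXn hYn fun j h1 hj => ?_
    rw [omega_sub_bracket, omega_bracket_of_focal X _ x hX' h1 hj, hbo, hbo, hu j h1 hj]
    rcases Nat.lt_or_ge (j + 1) k with hj' | hj'
    · rw [hw j h1 hj', hu (j + 1) (by omega) hj']; simp
    · obtain rfl : k = j + 1 := by omega
      rw [huk, hXr, hc]
      split_ifs <;> simp
  have := bracket_add_mem (S := lieSquareModule I x 2) (T := lieSquareModule I x 2)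
    (Submodule.mem_sup_right hX) hb key
  rwa [add_sub_cancel] at this

end Modules

end Monster

namespace Monster

/-! ### Germs of smooth functions and the derivations given by vector fields -/

section SmoothGerms

variable {𝕜 : Type*} [RCLike 𝕜] {E : Type*} [NormedAddCommGroup E] [NormedSpace 𝕜 E]

variable (𝕜) in
/-- The ring of germs at `p` of smooth functions. -/
def smoothGerm (p : E) : Subring (Filter.Germ (𝓝 p) 𝕜) where
  carrier := {g | ∃ f : E → 𝕜, ContDiffAt 𝕜 ∞ f p ∧ (f : Filter.Germ (𝓝 p) 𝕜) = g}
  mul_mem' := by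
    rintro _ _ ⟨f, hf, rfl⟩ ⟨g, hg, rfl⟩
    exact ⟨f * g, hf.mul hg, rfl⟩
  one_mem' := ⟨1, contDiffAt_const, rfl⟩
  add_mem' := by
    rintro _ _ ⟨f, hf, rfl⟩ ⟨g, hg, rfl⟩
    exact ⟨f + g, hf.add hg, rfl⟩
  zero_mem' := ⟨0, contDiffAt_const, rfl⟩
  neg_mem' := by
    rintro _ ⟨f, hf, rfl⟩
    exact ⟨-f, hf.neg, rfl⟩

variable {p : E}

/-- The germ of a smooth function. -/
def toGerm (f : E → 𝕜) (hf : ContDiffAt 𝕜 ∞ f p) : smoothGerm 𝕜 p := ⟨f, f, hf, rfl⟩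

theorem toGerm_eq_iff {f g : E → 𝕜} {hf : ContDiffAt 𝕜 ∞ f p} {hg : ContDiffAt 𝕜 ∞ g p} :
    toGerm f hf = toGerm g hg ↔ f =ᶠ[𝓝 p] g :=
  Subtype.ext_iff.trans Filter.Germ.coe_eq

theorem exists_toGerm (g : smoothGerm 𝕜 p) : ∃ f hf, g = toGerm f hf := by
  obtain ⟨_, f, hf, rfl⟩ := g
  exact ⟨f, hf, rfl⟩

variable (𝕜) in
/-- Evaluation of germs of functions at the base point. -/
def evalGerm (p : E) : smoothGerm 𝕜 p →+* 𝕜 :=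
  Filter.Germ.valueRingHom.comp (smoothGerm 𝕜 p).subtype

theorem contDiffAt_dirDer {f : E → 𝕜} (hf : ContDiffAt 𝕜 ∞ f p) {z : E → E}
    (hz : ContDiffAt 𝕜 ∞ z p) : ContDiffAt 𝕜 ∞ (fun y => fderiv 𝕜 f y (z y)) p :=
  (hf.fderiv_right (m := ∞) (by simp)).clm_apply hz

theorem eventually_differentiableAt {F : Type*} [NormedAddCommGroup F] [NormedSpace 𝕜 F]
    {f : E → F} (hf : ContDiffAt 𝕜 ∞ f p) : ∀ᶠ y in 𝓝 p, DifferentiableAt 𝕜 f y :=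
  ((hf.of_le (m := 1) (by simp)).eventually (by simp)).mono fun _ hy =>
    hy.differentiableAt (by simp)

/-- The action of a smooth vector field on germs of functions. -/
noncomputable def dirDerFun (z : E → E) (hz : ContDiffAt 𝕜 ∞ z p) (g : smoothGerm 𝕜 p) : smoothGerm 𝕜 p :=
  ⟨g.1.liftOn (fun f => ((fun y => fderiv 𝕜 f y (z y) : E → 𝕜) : Filter.Germ (𝓝 p) 𝕜))
    fun _ _ h => Filter.Germ.coe_eq.mpr ((h.fderiv (𝕜 := 𝕜)).mono fun _ hy => by simp only [hy]), by
      obtain ⟨_, f, hf, rfl⟩ := g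
      exact ⟨_, contDiffAt_dirDer hf hz, rfl⟩⟩

theorem dirDerFun_toGerm {z : E → E} (hz : ContDiffAt 𝕜 ∞ z p) {f : E → 𝕜}
    (hf : ContDiffAt 𝕜 ∞ f p) : dirDerFun z hz (toGerm f hf) =
      toGerm (fun y => fderiv 𝕜 f y (z y)) (contDiffAt_dirDer hf hz) := rfl

/-- The derivation of the ring of germs given by a smooth vector field. -/
noncomputable def dirDer (z : E → E) (hz : ContDiffAt 𝕜 ∞ z p) :
    Derivation ℤ (smoothGerm 𝕜 p) (smoothGerm 𝕜 p) :=
  Derivation.mk' (AddMonoidHom.toIntLinearMap (AddMonoidHom.mk' (dirDerFun z hz) (by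
    intro a b
    obtain ⟨f, hf, rfl⟩ := exists_toGerm a
    obtain ⟨g, hg, rfl⟩ := exists_toGerm b
    change dirDerFun z hz (toGerm (f + g) (hf.add hg)) =
      toGerm ((fun y => fderiv 𝕜 f y (z y)) + fun y => fderiv 𝕜 g y (z y))
        ((contDiffAt_dirDer hf hz).add (contDiffAt_dirDer hg hz))
    rw [dirDerFun_toGerm, toGerm_eq_iff]
    filter_upwards [eventually_differentiableAt hf, eventually_differentiableAt hg] with y h1 h2
    simp [fderiv_add h1 h2]))) (by
    intro a b
    obtain ⟨f, hf, rfl⟩ := exists_toGerm a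
    obtain ⟨g, hg, rfl⟩ := exists_toGerm b
    change dirDerFun z hz (toGerm (f * g) (hf.mul hg)) =
      toGerm (f * (fun y => fderiv 𝕜 g y (z y)) + g * fun y => fderiv 𝕜 f y (z y))
        ((hf.mul (contDiffAt_dirDer hg hz)).add (hg.mul (contDiffAt_dirDer hf hz)))
    rw [dirDerFun_toGerm, toGerm_eq_iff]
    filter_upwards [eventually_differentiableAt hf, eventually_differentiableAt hg] with y h1 h2
    simp [fderiv_mul h1 h2])

theorem dirDer_toGerm {z : E → E} (hz : ContDiffAt 𝕜 ∞ z p) {f : E → 𝕜}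
    (hf : ContDiffAt 𝕜 ∞ f p) : dirDer z hz (toGerm f hf) =
      toGerm (fun y => fderiv 𝕜 f y (z y)) (contDiffAt_dirDer hf hz) := rfl

end SmoothGerms

/-! ### Vector fields as tuples of germs -/

section Components

variable {𝕜 : Type*} [RCLike 𝕜] {k : ℕ} {I : Finset ℕ} {p : Fin (k + 2) → 𝕜}

theorem contDiffAt_component {z : (Fin (k + 2) → 𝕜) → (Fin (k + 2) → 𝕜)}
    (hz : ContDiffAt 𝕜 ∞ z p) (i : Fin (k + 2)) : ContDiffAt 𝕜 ∞ (fun y => z y i) p :=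
  contDiffAt_pi.mp hz i

/-- The germs of the components of a vector field. -/
def comp (z : (Fin (k + 2) → 𝕜) → (Fin (k + 2) → 𝕜)) (hz : ContDiffAt 𝕜 ∞ z p) (i : Fin (k + 2)) :
    smoothGerm 𝕜 p := toGerm (fun y => z y i) (contDiffAt_component hz i)

variable (𝕜) in
/-- The germs of the coordinate functions. -/
def coordGerm (p : Fin (k + 2) → 𝕜) : Fin (k + 2) → smoothGerm 𝕜 p := comp id contDiffAt_id

theorem dirDer_coordGerm {z : (Fin (k + 2) → 𝕜) → (Fin (k + 2) → 𝕜)} (hz : ContDiffAt 𝕜 ∞ z p)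
    (i : Fin (k + 2)) : dirDer z hz (coordGerm 𝕜 p i) = comp z hz i := by
  rw [coordGerm, comp, dirDer_toGerm, comp, toGerm_eq_iff]
  refine Filter.Eventually.of_forall fun y => ?_
  have : fderiv 𝕜 (fun y : Fin (k + 2) → 𝕜 => id y i) y =
      ContinuousLinearMap.proj (R := 𝕜) (φ := fun _ : Fin (k + 2) => 𝕜) i :=
    (ContinuousLinearMap.proj (R := 𝕜) (φ := fun _ : Fin (k + 2) => 𝕜) i).fderiv
  simp only [this]; rfl

theorem contDiffAt_omega {z : (Fin (k + 2) → 𝕜) → (Fin (k + 2) → 𝕜)} (hz : ContDiffAt 𝕜 ∞ z p)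
    (j : ℕ) : ContDiffAt 𝕜 ∞ (fun y => omega I y (z y) j) p :=
  (contDiffAt_component hz _).sub
    ((contDiffAt_component (contDiffAt_id (𝕜 := 𝕜)) _).mul (contDiffAt_component hz _))

theorem omega_comp {z : (Fin (k + 2) → 𝕜) → (Fin (k + 2) → 𝕜)} (hz : ContDiffAt 𝕜 ∞ z p)
    (j : ℕ) : omega I (coordGerm 𝕜 p) (comp z hz) j =
      toGerm (fun y => omega I y (z y) j) (contDiffAt_omega hz j) := rfl

theorem omega_comp_eq_zero {z : (Fin (k + 2) → 𝕜) → (Fin (k + 2) → 𝕜)}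
    (hz : ContDiffAt 𝕜 ∞ z p) {j : ℕ} (h : ∀ᶠ y in 𝓝 p, omega I y (z y) j = 0) :
    omega I (coordGerm 𝕜 p) (comp z hz) j = 0 :=
  (omega_comp hz j).trans (toGerm_eq_iff (g := 0) (hg := contDiffAt_const).mpr h)

theorem contDiffAt_lieBracket {a b : (Fin (k + 2) → 𝕜) → (Fin (k + 2) → 𝕜)}
    (ha : ContDiffAt 𝕜 ∞ a p) (hb : ContDiffAt 𝕜 ∞ b p) :
    ContDiffAt 𝕜 ∞ (VectorField.lieBracket 𝕜 a b) p :=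
  ((hb.fderiv_right (m := ∞) (by simp)).clm_apply ha).sub
    ((ha.fderiv_right (m := ∞) (by simp)).clm_apply hb)

/-- Through this identity the bracket formulas for derivations apply to Lie brackets of smooth
fields. -/
theorem comp_lieBracket {a b : (Fin (k + 2) → 𝕜) → (Fin (k + 2) → 𝕜)}
    (ha : ContDiffAt 𝕜 ∞ a p) (hb : ContDiffAt 𝕜 ∞ b p) :
    comp _ (contDiffAt_lieBracket ha hb) = fun i =>
      dirDer a ha (dirDer b hb (coordGerm 𝕜 p i)) -
        dirDer b hb (dirDer a ha (coordGerm 𝕜 p i)) := by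
  funext i
  rw [dirDer_coordGerm, dirDer_coordGerm]
  change _ = toGerm ((fun y => fderiv 𝕜 (fun y => b y i) y (a y)) -
    fun y => fderiv 𝕜 (fun y => a y i) y (b y))
    ((contDiffAt_dirDer (contDiffAt_component hb i) ha).sub
      (contDiffAt_dirDer (contDiffAt_component ha i) hb))
  rw [comp, toGerm_eq_iff]
  filter_upwards [eventually_differentiableAt ha, eventually_differentiableAt hb] with y h1 h2
  simp [VectorField.lieBracket_eq, fderiv_apply h1, fderiv_apply h2]

end Components

end Monster

namespace Monster

/-! ### Orders of vanishing in one variable -/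

section Curves

variable {𝕜 : Type*} [RCLike 𝕜]

/-- `φ` is smooth at `0` and vanishes there to order at least `m`. -/
def JetVanishes : ℕ → (𝕜 → 𝕜) → Prop
  | 0, φ => ContDiffAt 𝕜 ∞ φ 0
  | m + 1, φ => ContDiffAt 𝕜 ∞ φ 0 ∧ φ 0 = 0 ∧ JetVanishes m (deriv φ)

namespace JetVanishes

theorem deriv_contDiffAt {φ : 𝕜 → 𝕜} (h : ContDiffAt 𝕜 ∞ φ 0) : ContDiffAt 𝕜 ∞ (deriv φ) 0 :=
  ContDiffAt.derivWithin h (by simp)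

theorem congr {m : ℕ} {φ ψ : 𝕜 → 𝕜} (h : JetVanishes m φ) (he : ψ =ᶠ[𝓝 0] φ) :
    JetVanishes m ψ := by
  induction m generalizing φ ψ with
  | zero => exact ContDiffAt.congr_of_eventuallyEq h he
  | succ m ih =>
    exact ⟨h.1.congr_of_eventuallyEq he, he.eq_of_nhds.trans h.2.1, ih h.2.2 he.deriv⟩

theorem of_succ {m : ℕ} {φ : 𝕜 → 𝕜} (h : JetVanishes (m + 1) φ) : JetVanishes m φ := by
  induction m generalizing φ with
  | zero => exact h.1
  | succ m ih => exact ⟨h.1, h.2.1, ih h.2.2⟩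

theorem add {m : ℕ} {φ ψ : 𝕜 → 𝕜} (hφ : JetVanishes m φ) (hψ : JetVanishes m ψ) :
    JetVanishes m (φ + ψ) := by
  induction m generalizing φ ψ with
  | zero => exact ContDiffAt.add hφ hψ
  | succ m ih =>
    refine ⟨hφ.1.add hψ.1, by simp [hφ.2.1, hψ.2.1], (ih hφ.2.2 hψ.2.2).congr ?_⟩
    filter_upwards [eventually_differentiableAt hφ.1, eventually_differentiableAt hψ.1]
      with t h1 h2
    rw [deriv_add h1 h2]; rfl

theorem mul_left {m : ℕ} {φ α : 𝕜 → 𝕜} (hα : ContDiffAt 𝕜 ∞ α 0) (hφ : JetVanishes m φ) :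
    JetVanishes m (α * φ) := by
  induction m generalizing φ α with
  | zero => exact ContDiffAt.mul hα hφ
  | succ m ih =>
    refine ⟨hα.mul hφ.1, by simp [hφ.2.1],
      ((ih (deriv_contDiffAt hα) hφ.of_succ).add (ih hα hφ.2.2)).congr ?_⟩
    filter_upwards [eventually_differentiableAt hα, eventually_differentiableAt hφ.1]
      with t h1 h2
    rw [deriv_mul h1 h2]; rfl

theorem iteratedDeriv_eq_zero {m : ℕ} {φ : 𝕜 → 𝕜} (h : JetVanishes m φ) {n : ℕ} (hn : n < m) :
    iteratedDeriv n φ 0 = 0 := by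
  induction n generalizing m φ with
  | zero =>
    obtain ⟨m, rfl⟩ : ∃ l, m = l + 1 := ⟨m - 1, by omega⟩
    simpa using h.2.1
  | succ n ih =>
    obtain ⟨m, rfl⟩ : ∃ l, m = l + 1 := ⟨m - 1, by omega⟩
    rw [iteratedDeriv_succ']
    exact ih h.2.2 (by omega)

theorem le_vanishingOrder {m : ℕ} {φ : 𝕜 → 𝕜} (h : JetVanishes m φ) : m ≤ vanishingOrder φ :=
  le_iInf₂ fun n hn => by
    by_contra hlt
    exact hn (h.iteratedDeriv_eq_zero (by simpa using hlt))

end JetVanishes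

end Curves

/-! ### Word orders against focal orders, smooth and holomorphic setting -/

section AnalyticFrame

variable {𝕜 : Type*} [RCLike 𝕜] {k : ℕ} {I : Finset ℕ} {p : Fin (k + 2) → 𝕜}

theorem anG_apply (i : ℕ) (y : Fin (k + 2) → 𝕜) :
    anG 𝕜 k I i y = spG k I y (stdPd 𝕜 k) i :=
  map_spG (Pi.evalRingHom (fun _ : Fin (k + 2) → 𝕜 => 𝕜) y)
    (Pi.evalAddMonoidHom (fun _ : Fin (k + 2) → 𝕜 => Fin (k + 2) → 𝕜) y) (fun _ _ => rfl) k I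
    (coordFun 𝕜 k) (coordVF 𝕜 k) i

theorem contDiff_coordFun (i : Fin (k + 2)) : ContDiff 𝕜 ∞ (coordFun 𝕜 k i) :=
  contDiff_apply 𝕜 𝕜 i

theorem contDiff_stdF (l : ℕ) :
    ContDiff 𝕜 ∞ (stdF k I (coordFun 𝕜 k) (coordVF 𝕜 k) l) := by
  induction l with
  | zero => exact contDiff_const
  | succ l ih =>
    simp only [stdF]
    split_ifs
    · exact ((contDiff_coordFun _).smul ih).add contDiff_const
    · exact ih.add ((contDiff_coordFun _).smul contDiff_const)

theorem contDiff_anG (i : ℕ) : ContDiff 𝕜 ∞ (anG 𝕜 k I i) := by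
  have key : ∀ (c : ℤ) (f : (Fin (k + 2) → 𝕜) → Fin (k + 2) → 𝕜), ContDiff 𝕜 ∞ f →
      ContDiff 𝕜 ∞ (c • f) := by
    intro c f hf
    have : c • f = fun y => (c : 𝕜) • f y := by
      funext y; rw [Pi.smul_apply, Int.cast_smul_eq_zsmul]
    rw [this]
    exact (contDiff_const (c := (c : 𝕜))).smul hf
  rcases i with _ | _ | i
  · exact contDiff_stdF k
  · exact contDiff_const
  · simp only [anG, spG]
    split_ifs
    · exact key _ _ (contDiff_stdF _)
    · exact key _ _ contDiff_const

theorem isFocalVec_iff {y z : Fin (k + 2) → 𝕜} :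
    IsFocalVec I y z ↔ ∀ i, 1 ≤ i → i ≤ k → omega I y z i = 0 := focal_iff

theorem IsFocalVec.eq {y z : Fin (k + 2) → 𝕜} (h : IsFocalVec I y z) :
    z = z (retIdx k I k) • anG 𝕜 k I 0 y + z (newIdx k k) • anG 𝕜 k I 1 y := by
  rw [anG_apply, anG_apply]
  exact eq_of_omega_eq_zero (isFocalVec_iff.mp h)

variable (𝕜) in
/-- The derivations of the ring of germs at `p` given by `g_0` and `g_1`. -/
noncomputable def germFrame (I : Finset ℕ) (p : Fin (k + 2) → 𝕜) :
    Set (Derivation ℤ (smoothGerm 𝕜 p) (smoothGerm 𝕜 p)) :=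
  {dirDer (anG 𝕜 k I 0) (contDiff_anG 0).contDiffAt,
    dirDer (anG 𝕜 k I 1) (contDiff_anG 1).contDiffAt}

theorem wordOrd_dirDer {a : (Fin (k + 2) → 𝕜) → (Fin (k + 2) → 𝕜)} (ha : ContDiffAt 𝕜 ∞ a p)
    (hf : ∀ᶠ y in 𝓝 p, IsFocalVec I y (a y)) (m : ℕ) (f : smoothGerm 𝕜 p)
    (h : WordOrd (germFrame 𝕜 I p) (RingHom.ker (evalGerm 𝕜 p)) (m + 1) f) :
    WordOrd (germFrame 𝕜 I p) (RingHom.ker (evalGerm 𝕜 p)) m (dirDer a ha f) := by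
  refine WordOrd.derivation (α := comp a ha (retIdx k I k)) (β := comp a ha (newIdx k k)) ?_ h
  refine Derivation.ext fun g => ?_
  obtain ⟨g, hg, rfl⟩ := exists_toGerm g
  change toGerm (fun y => fderiv 𝕜 g y (a y)) (contDiffAt_dirDer hg ha) =
    toGerm ((fun y => a y (retIdx k I k)) * (fun y => fderiv 𝕜 g y (anG 𝕜 k I 0 y)) +
      (fun y => a y (newIdx k k)) * (fun y => fderiv 𝕜 g y (anG 𝕜 k I 1 y)))
      (((contDiffAt_component ha _).mul (contDiffAt_dirDer hg (contDiff_anG 0).contDiffAt)).add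
        ((contDiffAt_component ha _).mul (contDiffAt_dirDer hg (contDiff_anG 1).contDiffAt)))
  refine toGerm_eq_iff.mpr (hf.mono fun y hy => ?_)
  beta_reduce
  conv_lhs => rw [hy.eq]
  simp

/-- Since γ' is focal, the derivative of f ∘ γ is a combination of (g_0 f) ∘ γ and (g_1 f) ∘ γ,
which have word order one less. -/
theorem vanishing_of_wordOrd {γ : 𝕜 → Fin (k + 2) → 𝕜} (hγ : IsFocalCurve I p γ) {m : ℕ}
    {f : (Fin (k + 2) → 𝕜) → 𝕜} (hf : ContDiffAt 𝕜 ∞ f p)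
    (h : WordOrd (germFrame 𝕜 I p) (RingHom.ker (evalGerm 𝕜 p)) m (toGerm f hf)) :
    JetVanishes m (f ∘ γ) := by
  obtain ⟨rfl, -, ε, hε, hγs, hγf⟩ := hγ
  have hγ0 : ContDiffAt 𝕜 ∞ γ 0 := hγs.contDiffAt (Metric.ball_mem_nhds 0 hε)
  induction m generalizing f with
  | zero => exact hf.comp 0 hγ0
  | succ m ih =>
    refine ⟨hf.comp 0 hγ0, h.1, ?_⟩
    have hX := ih (contDiffAt_dirDer hf (contDiff_anG 0).contDiffAt) (h.2 _ (Or.inl rfl))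
    have hY := ih (contDiffAt_dirDer hf (contDiff_anG 1).contDiffAt) (h.2 _ (Or.inr rfl))
    have hd : ContDiffAt 𝕜 ∞ (deriv γ) 0 :=
      ContDiffAt.derivWithin hγ0 (by simp)
    refine ((hX.mul_left (contDiffAt_pi.mp hd (retIdx k I k))).add
      (hY.mul_left (contDiffAt_pi.mp hd (newIdx k k)))).congr ?_
    filter_upwards [hγ0.continuousAt.eventually (eventually_differentiableAt hf),
      eventually_differentiableAt hγ0, Metric.ball_mem_nhds 0 hε] with t h1 h2 h3
    rw [fderiv_comp_deriv t h1 h2]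
    conv_lhs => rw [(hγf t h3).eq]
    simp

theorem le_focalOrder {m : ℕ} {f : (Fin (k + 2) → 𝕜) → 𝕜} (hf : ContDiffAt 𝕜 ∞ f p)
    (h : WordOrd (germFrame 𝕜 I p) (RingHom.ker (evalGerm 𝕜 p)) m (toGerm f hf)) :
    m ≤ focalOrder I p f :=
  le_iInf₂ fun _ hγ => (vanishing_of_wordOrd hγ hf h).le_vanishingOrder

open Polynomial in
theorem iteratedDeriv_eval (P : 𝕜[X]) (n : ℕ) :
    iteratedDeriv n (fun t => P.eval t) 0 = (derivative^[n] P).eval 0 := by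
  induction n generalizing P with
  | zero => simp
  | succ n ih =>
    rw [iteratedDeriv_succ', Function.iterate_succ_apply, ← ih]
    congr 1
    funext t
    exact P.deriv

open Polynomial in
theorem vanishingOrder_eval_le {P : 𝕜[X]} (hP : P ≠ 0) :
    vanishingOrder (fun t => P.eval t) ≤ (P.rootMultiplicity 0 : ℕ) := by
  have h := (lt_rootMultiplicity_iff_isRoot_iterate_derivative (t := 0)
    (n := P.rootMultiplicity 0) hP).not.mp (lt_irrefl _)
  push Not at h
  obtain ⟨m, hm, h⟩ := h
  refine (iInf₂_le m ?_).trans (by exact_mod_cast hm)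
  rw [iteratedDeriv_eval]
  exact h

open Polynomial in
theorem isFocalCurve_eval {q : Fin (k + 2) → 𝕜[X]} (h0 : ∀ i, (q i).eval 0 = p i)
    (hq : ∀ j, 1 ≤ j → j ≤ k → omega I q (fun i => derivative (q i)) j = 0)
    (hn : derivative (q (newIdx k k)) = 1) : IsFocalCurve I p fun t i => (q i).eval t := by
  have hd : ∀ t, deriv (fun t i => (q i).eval t) t = fun i => (derivative (q i)).eval t := by
    intro t
    rw [deriv_pi fun i => (q i).differentiable t]
    funext i
    exact (q i).deriv
  refine ⟨funext h0, fun h => ?_, 1, one_pos, ?_, fun t _ => ?_⟩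
  · rw [hd] at h
    have := congrFun h (newIdx k k)
    simp [hn] at this
  · exact (contDiff_pi.mpr fun i => (q i).contDiff_aeval ∞).contDiffOn
  · rw [isFocalVec_iff, hd]
    intro j h1 h2
    have := congrArg (evalRingHom t) (hq j h1 h2)
    rwa [map_omega, map_zero] at this

/-- Bounds for the vertical orders and for the word orders of the coordinate functions, by the
orders of these functions along the generic curve. -/
theorem exists_orders (k : ℕ) (I : Finset ℕ) (p : Fin (k + 2) → 𝕜) : ∃ μ : ℕ → ℕ,
    (∀ j, 1 ≤ j → j ≤ k → verticalOrder I p j ≤ μ j) ∧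
    ∀ j, 1 ≤ j → j ≤ k → WordOrd (germFrame 𝕜 I p) (RingHom.ker (evalGerm 𝕜 p)) (μ j)
      (if j ∈ I then coordGerm 𝕜 p (newIdx k j) else 1) := by
  -- One curve serves both bounds: it is a competitor in the infimum defining the vertical order,
  -- and its orders bound the word orders from below.
  obtain ⟨q, h0, hq, hr, hn⟩ := exists_generic_curve k I p
  refine ⟨fun j => if j ∈ I then (q (newIdx k j)).rootMultiplicity 0 else 0, ?_, ?_⟩
  · intro j h1 hj
    refine (iInf₂_le _ (isFocalCurve_eval h0 hq hn)).trans ?_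
    beta_reduce
    split_ifs with h
    · exact vanishingOrder_eval_le
        (newIdx_ne_zero_of_generic hq hr hn (Nat.zero_le k) j (Nat.zero_le j) hj)
    · refine (iInf₂_le 0 ?_)
      simp
  · intro j h1 hj
    beta_reduce
    split_ifs
    · refine wordOrd_newIdx ?_ hq hr hn (fun i hi => ?_) (Nat.zero_le k) j (Nat.zero_le j) hj
      · have key : ∀ i, (∀ (y : Fin (k + 2) → 𝕜) j, 1 ≤ j → j ≤ k →
            omega I y (spG k I y (stdPd 𝕜 k) i) j = 0) → ∀ j, 1 ≤ j → j ≤ k →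
            omega I (coordGerm 𝕜 p) (fun l => dirDer (p := p) (anG 𝕜 k I i)
              (contDiff_anG i).contDiffAt (coordGerm 𝕜 p l)) j = 0 := by
          intro i hi j h1 h2
          simp only [dirDer_coordGerm]
          exact omega_comp_eq_zero _ (Filter.Eventually.of_forall fun y => by
            rw [anG_apply]; exact hi y j h1 h2)
        rintro a (rfl | rfl)
        · exact key 0 fun y j h1 h2 => omega_spG_zero y h1 h2
        · exact key 1 fun y j h1 h2 => omega_spG_one y h1 h2
      · exact (h0 i).symm.trans hi
    · trivial

end AnalyticFrame

end Monster

namespace Monster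

/-! ### The decomposition, smooth and holomorphic setting -/

section AnalyticSheaves

variable {𝕜 : Type*} [RCLike 𝕜] {k : ℕ} {I : Finset ℕ} {p : Fin (k + 2) → 𝕜}

theorem toGerm_add {E : Type*} [NormedAddCommGroup E] [NormedSpace 𝕜 E] {q : E} {f g : E → 𝕜}
    (hf : ContDiffAt 𝕜 ∞ f q) (hg : ContDiffAt 𝕜 ∞ g q) :
    toGerm f hf + toGerm g hg = toGerm (fun y => f y + g y) (hf.add hg) := rfl

theorem toGerm_sum {E : Type*} [NormedAddCommGroup E] [NormedSpace 𝕜 E] {q : E} {ι : Type*}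
    (s : Finset ι) (f : ι → E → 𝕜) (hf : ∀ i, ContDiffAt 𝕜 ∞ (f i) q) :
    ∑ i ∈ s, toGerm (f i) (hf i) =
      toGerm (fun y => ∑ i ∈ s, f i y) (ContDiffAt.sum fun i _ => hf i) := by
  classical
  induction s using Finset.induction_on with
  | empty => rfl
  | insert a s ha ih =>
    rw [Finset.sum_insert ha, ih, toGerm_add]
    exact toGerm_eq_iff.mpr (Filter.Eventually.of_forall fun y => by simp [Finset.sum_insert ha])

theorem smallGrowthSheaf_contDiffOn {h : ℕ} {W : Set (Fin (k + 2) → 𝕜)}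
    {z : (Fin (k + 2) → 𝕜) → (Fin (k + 2) → 𝕜)} (hz : smallGrowthSheaf k I h W z) :
    ContDiffOn 𝕜 ∞ z W := by
  rcases h with _ | _ | h <;> exact hz.1

theorem dirDer_coordGerm_eq {z : (Fin (k + 2) → 𝕜) → (Fin (k + 2) → 𝕜)}
    (hz : ContDiffAt 𝕜 ∞ z p) : (fun i => dirDer z hz (coordGerm 𝕜 p i)) = comp z hz :=
  funext fun i => dirDer_coordGerm hz i

theorem omega_comp_eq_zero_of_focal {a : (Fin (k + 2) → 𝕜) → (Fin (k + 2) → 𝕜)}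
    (ha : ContDiffAt 𝕜 ∞ a p) (hf : ∀ᶠ y in 𝓝 p, IsFocalVec I y (a y)) {j : ℕ} (h1 : 1 ≤ j)
    (h2 : j ≤ k) : omega I (coordGerm 𝕜 p) (comp a ha) j = 0 :=
  omega_comp_eq_zero _ (hf.mono fun _ hy => isFocalVec_iff.mp hy j h1 h2)

theorem growthBound_of_smallGrowthSheaf {μ : ℕ → ℕ}
    (hμ : ∀ j, 1 ≤ j → j ≤ k → WordOrd (germFrame 𝕜 I p) (RingHom.ker (evalGerm 𝕜 p)) (μ j)
      (if j ∈ I then coordGerm 𝕜 p (newIdx k j) else 1)) {h : ℕ} (hh : 1 ≤ h)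
    {W : Set (Fin (k + 2) → 𝕜)} (hW : IsOpen W) (hp : p ∈ W)
    {z : (Fin (k + 2) → 𝕜) → (Fin (k + 2) → 𝕜)} (hz : smallGrowthSheaf k I h W z)
    (hzp : ContDiffAt 𝕜 ∞ z p) :
    GrowthBound (germFrame 𝕜 I p) (RingHom.ker (evalGerm 𝕜 p)) I (coordGerm 𝕜 p) μ h
      (comp z hzp) := by
  induction h, hh using Nat.le_induction generalizing z W with
  | base =>
    exact GrowthBound.of_focal fun j h1 h2 =>
      omega_comp_eq_zero_of_focal hzp (Filter.mem_of_superset (hW.mem_nhds hp) hz.2) h1 h2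
  | succ h hh ih =>
    obtain ⟨h, rfl⟩ : ∃ l, h = l + 1 := ⟨h - 1, by omega⟩
    obtain ⟨V, hV, hpV, -, m, a, b, c, ha, hb, hc, he⟩ := hz.2 p hp
    have hVp := hV.mem_nhds hpV
    have ha' := fun s => (ha s).1.contDiffAt hVp
    have hb' := fun s => (smallGrowthSheaf_contDiffOn (hb s)).contDiffAt hVp
    have hc' := (smallGrowthSheaf_contDiffOn hc).contDiffAt hVp
    have key : comp z hzp =
        ∑ s, comp _ (contDiffAt_lieBracket (ha' s) (hb' s)) + comp c hc' := by
      funext i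
      rw [Pi.add_apply, Finset.sum_apply]
      simp only [comp]
      rw [toGerm_sum _ _ fun s => contDiffAt_component (contDiffAt_lieBracket (ha' s) (hb' s)) i,
        toGerm_add]
      refine toGerm_eq_iff.mpr ?_
      filter_upwards [hVp] with y hy
      simp [he y hy]
    rw [key]
    refine (GrowthBound.sum fun s _ => ?_).add (ih hV hpV hc hc').succ
    have haf : ∀ᶠ y in 𝓝 p, IsFocalVec I y (a s y) := Filter.mem_of_superset hVp (ha s).2
    rw [comp_lieBracket]
    refine GrowthBound.bracket hμ _ _ (wordOrd_dirDer (ha' s) haf) (fun j h1 h2 => ?_) hh ?_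
    · rw [dirDer_coordGerm_eq]
      exact omega_comp_eq_zero_of_focal (ha' s) haf h1 h2
    · rw [dirDer_coordGerm_eq]
      exact ih hV hpV (hb s) (hb' s)

/-- The bracket formula for germs, evaluated at the base point; the term a(ω_j(b)) drops out because
ω_j(b) vanishes near p. -/
theorem omega_lieBracket_of_focal {a b : (Fin (k + 2) → 𝕜) → (Fin (k + 2) → 𝕜)}
    (ha : ContDiffAt 𝕜 ∞ a p) (hb : ContDiffAt 𝕜 ∞ b p)
    (haf : ∀ᶠ y in 𝓝 p, IsFocalVec I y (a y)) {j : ℕ} (h1 : 1 ≤ j) (hj : j < k)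
    (hbj : ∀ᶠ y in 𝓝 p, omega I y (b y) j = 0) :
    omega I p (VectorField.lieBracket 𝕜 a b p) j =
      (if j + 1 ∈ I then 1 else -1) * (a p (retIdx k I (j + 1)) * omega I p (b p) (j + 1)) := by
  have h := omega_bracket_of_focal (I := I) (dirDer a ha) (dirDer b hb) (coordGerm 𝕜 p)
    (fun i h1 h2 => by
      rw [dirDer_coordGerm_eq]; exact omega_comp_eq_zero_of_focal ha haf h1 h2) h1 hj
  rw [← comp_lieBracket, dirDer_coordGerm_eq, omega_comp_eq_zero hb hbj, map_zero, zero_add,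
    dirDer_coordGerm] at h
  have h' := congrArg (evalGerm 𝕜 p) h
  rw [map_mul, map_mul] at h'
  have e : evalGerm 𝕜 p (if j + 1 ∈ I then 1 else -1) = if j + 1 ∈ I then 1 else -1 := by
    split_ifs <;> simp
  rw [e] at h'
  exact h'

theorem omega_lieBracket_of_focal_self {a b : (Fin (k + 2) → 𝕜) → (Fin (k + 2) → 𝕜)}
    (ha : ContDiffAt 𝕜 ∞ a p) (hb : ContDiffAt 𝕜 ∞ b p)
    (haf : ∀ᶠ y in 𝓝 p, IsFocalVec I y (a y)) (hbf : ∀ᶠ y in 𝓝 p, IsFocalVec I y (b y))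
    (hk : 1 ≤ k) (har : ∀ y, a y (retIdx k I k) = 1) (han : ∀ y, a y (newIdx k k) = 0) :
    omega I p (VectorField.lieBracket 𝕜 a b p) k = -b p (newIdx k k) := by
  have h := omega_bracket_of_focal_self (I := I) (dirDer a ha) (dirDer b hb) (coordGerm 𝕜 p)
    (fun i h1 h2 => by
      rw [dirDer_coordGerm_eq]; exact omega_comp_eq_zero_of_focal ha haf h1 h2)
    (fun i h1 h2 => by
      rw [dirDer_coordGerm_eq]; exact omega_comp_eq_zero_of_focal hb hbf h1 h2) hk
    (by
      rw [dirDer_coordGerm]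
      exact (toGerm_eq_iff (hg := contDiffAt_const (c := 1))).mpr (Filter.Eventually.of_forall har))
    (by
      rw [dirDer_coordGerm]
      exact (toGerm_eq_iff (hg := contDiffAt_const (c := 0))).mpr (Filter.Eventually.of_forall han))
  rw [← comp_lieBracket, dirDer_coordGerm] at h
  exact congrArg (evalGerm 𝕜 p) h

theorem bracketSheaf_of_sub {𝓐 𝓑 : VFSheaf 𝕜 k} {W : Set (Fin (k + 2) → 𝕜)} (hW : IsOpen W)
    {z a b : (Fin (k + 2) → 𝕜) → (Fin (k + 2) → 𝕜)} (hz : ContDiffOn 𝕜 ∞ z W) (ha : 𝓐 W a)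
    (hb : 𝓑 W b) (hc : 𝓑 W (z - VectorField.lieBracket 𝕜 a b)) : bracketSheaf 𝓐 𝓑 W z :=
  ⟨hz, fun _ hq => ⟨W, hW, hq, subset_rfl, 1, fun _ => a, fun _ => b, _, fun _ => ha, fun _ => hb,
    hc, fun y _ => by simp⟩⟩

theorem bracketSheaf_of_right {𝓐 𝓑 : VFSheaf 𝕜 k} {W : Set (Fin (k + 2) → 𝕜)} (hW : IsOpen W)
    {z : (Fin (k + 2) → 𝕜) → (Fin (k + 2) → 𝕜)} (hz : ContDiffOn 𝕜 ∞ z W) (hz' : 𝓑 W z) :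
    bracketSheaf 𝓐 𝓑 W z :=
  ⟨hz, fun _ hq => ⟨W, hW, hq, subset_rfl, 0, Fin.elim0, Fin.elim0, _, fun s => s.elim0,
    fun s => s.elim0, hz', fun y _ => by simp⟩⟩

theorem isFocalVec_anG_zero (y : Fin (k + 2) → 𝕜) : IsFocalVec I y (anG 𝕜 k I 0 y) := by
  rw [isFocalVec_iff, anG_apply]; exact fun i h1 h2 => omega_spG_zero y h1 h2

theorem isFocalVec_anG_one (y : Fin (k + 2) → 𝕜) : IsFocalVec I y (anG 𝕜 k I 1 y) := by
  rw [isFocalVec_iff, anG_apply]; exact fun i h1 h2 => omega_spG_one y h1 h2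

theorem focalSheaf_anG_zero (W : Set (Fin (k + 2) → 𝕜)) : focalSheaf k I W (anG 𝕜 k I 0) :=
  ⟨(contDiff_anG 0).contDiffOn, fun y _ => isFocalVec_anG_zero y⟩

theorem contDiffOn_omega {W : Set (Fin (k + 2) → 𝕜)} (hW : IsOpen W)
    {z : (Fin (k + 2) → 𝕜) → (Fin (k + 2) → 𝕜)} (hz : ContDiffOn 𝕜 ∞ z W) (j : ℕ) :
    ContDiffOn 𝕜 ∞ (fun y => omega I y (z y) j) W := fun _ hy =>
  (contDiffAt_omega (hz.contDiffAt (hW.mem_nhds hy)) j).contDiffWithinAt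

theorem contDiffOn_lieBracket {W : Set (Fin (k + 2) → 𝕜)} (hW : IsOpen W)
    {a b : (Fin (k + 2) → 𝕜) → (Fin (k + 2) → 𝕜)} (ha : ContDiffOn 𝕜 ∞ a W)
    (hb : ContDiffOn 𝕜 ∞ b W) : ContDiffOn 𝕜 ∞ (VectorField.lieBracket 𝕜 a b) W := fun _ hy =>
  (contDiffAt_lieBracket (ha.contDiffAt (hW.mem_nhds hy))
    (hb.contDiffAt (hW.mem_nhds hy))).contDiffWithinAt

theorem lieSquareSheaf_two {W : Set (Fin (k + 2) → 𝕜)} (hW : IsOpen W)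
    {w : (Fin (k + 2) → 𝕜) → (Fin (k + 2) → 𝕜)} (hw : ContDiffOn 𝕜 ∞ w W)
    (h : ∀ y ∈ W, ∀ j, 1 ≤ j → j < k → omega I y (w y) j = 0) : lieSquareSheaf k I 2 W w := by
  let b : (Fin (k + 2) → 𝕜) → (Fin (k + 2) → 𝕜) := fun y => (-omega I y (w y) k) • anG 𝕜 k I 1 y
  have hb : focalSheaf k I W b := by
    refine ⟨(contDiffOn_omega hW hw k).neg.smul (contDiff_anG 1).contDiffOn, fun y _ => ?_⟩
    rw [isFocalVec_iff]
    intro i h1 h2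
    rw [omega_smul, isFocalVec_iff.mp (isFocalVec_anG_one y) i h1 h2, mul_zero]
  refine bracketSheaf_of_sub hW hw (focalSheaf_anG_zero W) hb
    ⟨hw.sub (contDiffOn_lieBracket hW (contDiff_anG 0).contDiffOn hb.1), fun y hy => ?_⟩
  have hy' := hW.mem_nhds hy
  have hby := hb.1.contDiffAt hy'
  have hbf : ∀ᶠ y in 𝓝 y, IsFocalVec I y (b y) := Filter.mem_of_superset hy' hb.2
  rw [isFocalVec_iff]
  intro j h1 hj
  rw [Pi.sub_apply, omega_sub]
  rcases hj.eq_or_lt with rfl | hj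
  · rw [omega_lieBracket_of_focal_self (contDiff_anG 0).contDiffAt hby
      (Filter.Eventually.of_forall isFocalVec_anG_zero) hbf h1
      (fun y => by rw [anG_apply, spG_zero_retIdx]) fun y => by rw [anG_apply, spG_zero_newIdx]]
    simp [b, anG_apply, spG_one_newIdx]
  · rw [omega_lieBracket_of_focal (contDiff_anG 0).contDiffAt hby
      (Filter.Eventually.of_forall isFocalVec_anG_zero) h1 hj
      (hbf.mono fun y h => isFocalVec_iff.mp h j h1 hj.le), h y hy j h1 hj,
      isFocalVec_iff.mp (hb.2 y hy) (j + 1) (by omega) hj]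
    simp

theorem lieSquareSheaf_three {W : Set (Fin (k + 2) → 𝕜)} (hW : IsOpen W)
    {w : (Fin (k + 2) → 𝕜) → (Fin (k + 2) → 𝕜)} (hw : ContDiffOn 𝕜 ∞ w W)
    (h : ∀ y ∈ W, ∀ j, 1 ≤ j → j + 1 < k → omega I y (w y) j = 0) :
    lieSquareSheaf k I 3 W w := by
  rcases Nat.lt_or_ge k 2 with hk | hk
  · exact bracketSheaf_of_right hW hw (lieSquareSheaf_two hW hw fun y _ j h1 hj => by omega)
  let u : (Fin (k + 2) → 𝕜) → (Fin (k + 2) → 𝕜) := anG 𝕜 k I 2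
  have hu : ∀ y : Fin (k + 2) → 𝕜, ∀ j, 1 ≤ j → j ≤ k → omega I y (u y) j =
      if j = k then (spSign k I 2 : 𝕜) else 0 := fun y j h1 hj => by
    simp only [u, anG_apply]
    rw [omega_spG y le_rfl (by omega) h1 hj, Nat.add_sub_cancel]
  have hsq : (spSign k I 2 : 𝕜) * spSign k I 2 = 1 := by
    exact_mod_cast congrArg (Int.cast : ℤ → 𝕜) (spSign_mul_self k I 2)
  -- The first sign is that of the bracket formula at j + 1 = k, the second is ω_k(g_2); both are
  -- their own inverses.
  let b : (Fin (k + 2) → 𝕜) → (Fin (k + 2) → 𝕜) := fun y =>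
    ((if k ∈ I then 1 else -1) * spSign k I 2 * omega I y (w y) (k - 1)) • u y
  have hbs : ContDiffOn 𝕜 ∞ b W :=
    (contDiffOn_const.mul (contDiffOn_omega hW hw (k - 1))).smul (contDiff_anG 2).contDiffOn
  have hb0 : ∀ y j, 1 ≤ j → j < k → omega I y (b y) j = 0 := fun y j h1 hj => by
    rw [omega_smul, hu y j h1 hj.le, if_neg hj.ne, mul_zero]
  refine bracketSheaf_of_sub hW hw (a := anG 𝕜 k I 0) (b := b)
    (bracketSheaf_of_right hW (contDiff_anG 0).contDiffOn (focalSheaf_anG_zero W))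
    (lieSquareSheaf_two hW hbs fun y _ => hb0 y)
    (lieSquareSheaf_two hW (hw.sub (contDiffOn_lieBracket hW (contDiff_anG 0).contDiffOn hbs))
      fun y hy j h1 hj => ?_)
  rw [Pi.sub_apply, omega_sub, omega_lieBracket_of_focal (contDiff_anG 0).contDiffAt
    (hbs.contDiffAt (hW.mem_nhds hy)) (Filter.Eventually.of_forall isFocalVec_anG_zero) h1 hj
    (Filter.Eventually.of_forall fun y => hb0 y j h1 hj)]
  rcases Nat.lt_or_ge (j + 1) k with hj' | hj'
  · rw [h y hy j h1 hj', hb0 y (j + 1) (by omega) hj']; simp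
  · obtain rfl : k = j + 1 := by omega
    rw [anG_apply, spG_zero_retIdx, omega_smul, hu y _ (by omega) le_rfl, if_pos rfl,
      Nat.add_sub_cancel]
    split_ifs <;> linear_combination (-omega I y (w y) j) * hsq

theorem analytic_decomposition {W : Set (Fin (k + 2) → 𝕜)} (hW : IsOpen W) (hp : p ∈ W) {h : ℕ}
    (hh : 1 ≤ h) {z : (Fin (k + 2) → 𝕜) → (Fin (k + 2) → 𝕜)} (hz : smallGrowthSheaf k I h W z) :
    ∃ (w : (Fin (k + 2) → 𝕜) → (Fin (k + 2) → 𝕜)) (c : ℕ → (Fin (k + 2) → 𝕜) → 𝕜),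
      lieSquareSheaf k I 3 W w ∧
      (∀ i ∈ Finset.Icc 4 (min h (k + 1)), ContDiffOn 𝕜 ∞ (c i) W ∧
        eNum k (verticalOrder I p) h i ≤ focalOrder I p (c i)) ∧
      ∀ y ∈ W, z y = w y + ∑ i ∈ Finset.Icc 4 (min h (k + 1)), c i y • anG 𝕜 k I i y := by
  have hzs := smallGrowthSheaf_contDiffOn hz
  -- By duality this is the coefficient of g_i in z, the sign being its own inverse.
  let c : ℕ → (Fin (k + 2) → 𝕜) → 𝕜 := fun i y => spSign k I i * omega I y (z y) (k + 2 - i)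
  have hc : ∀ i, ContDiffOn 𝕜 ∞ (c i) W := fun i =>
    contDiffOn_const.mul (contDiffOn_omega hW hzs _)
  refine ⟨fun y => z y - ∑ i ∈ Finset.Icc 4 (min h (k + 1)), c i y • anG 𝕜 k I i y, c, ?_,
    fun i hi => ⟨hc i, ?_⟩, fun y _ => by simp⟩
  · refine lieSquareSheaf_three hW (hzs.sub (ContDiffOn.sum fun i _ =>
      (hc i).smul (contDiff_anG i).contDiffOn)) fun y hy j h1 hj => ?_
    rw [omega_sub, omega_sum]
    have e : ∀ i ∈ Finset.Icc 4 (min h (k + 1)), omega I y (c i y • anG 𝕜 k I i y) j =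
        if i = k + 2 - j then omega I y (z y) j else 0 := by
      intro i hi
      rw [Finset.mem_Icc, le_min_iff] at hi
      rw [omega_smul, anG_apply, omega_spG y (by omega) hi.2.2 h1 (by omega)]
      by_cases hij : i = k + 2 - j
      · have hij' : j = k + 2 - i := by omega
        have hsq : (spSign k I i : 𝕜) * spSign k I i = 1 := by
          exact_mod_cast congrArg (Int.cast : ℤ → 𝕜) (spSign_mul_self k I i)
        rw [if_pos hij', if_pos hij, mul_right_comm, hsq, one_mul, ← hij']
      · rw [if_neg hij, if_neg (by omega), mul_zero]
    rw [Finset.sum_congr rfl e, Finset.sum_ite_eq']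
    split_ifs with hm
    · exact sub_self _
    · rw [Finset.mem_Icc, le_min_iff] at hm
      have hzy := hzs.contDiffAt (hW.mem_nhds hy)
      -- Only the vanishing of the coefficients with i > h is needed, at an arbitrary point of W, so
      -- trivial orders suffice.
      have h0 := ((growthBound_of_smallGrowthSheaf (μ := fun _ => 0) (fun _ _ _ => trivial) hh hW
        hy hz hzy) (k + 2 - j) (by omega) (by omega)).1 (by omega)
      rw [show k + 2 - (k + 2 - j) = j by omega] at h0
      rw [sub_zero]
      exact congrArg (evalGerm 𝕜 y) h0
  · rw [Finset.mem_Icc, le_min_iff] at hi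
    obtain ⟨μ, hμ, hμ'⟩ := exists_orders k I p
    have hzp := hzs.contDiffAt (hW.mem_nhds hp)
    have hg := ((growthBound_of_smallGrowthSheaf hμ' hh hW hp hz hzp) i (by omega) hi.2.2).2
    exact (eNum_le_eNat h i hμ hi.2.2).trans (le_focalOrder
      (contDiffAt_const.mul (contDiffAt_omega hzp _))
      (hg.mul_left (toGerm (fun _ => (spSign k I i : 𝕜)) contDiffAt_const)))

end AnalyticSheaves

end Monster

namespace Monster

/-! ### Derivations in étale coordinates -/

section EtaleCoordinates

variable {K : Type*} [Field K] {B : Type*} [CommRing B] [Algebra K B] {n : ℕ}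
  [Algebra (MvPolynomial (Fin n) K) B] [IsScalarTower K (MvPolynomial (Fin n) K) B]
  [Algebra.FormallyEtale (MvPolynomial (Fin n) K) B]

theorem D_coordElt (i : Fin n) :
    KaehlerDifferential.D K B (coordElt K B n i) = dxBasis K B n i := by
  simp [dxBasis, coordElt]

/-- A derivation is determined by its values on étale coordinates. -/
theorem derivation_ext_coord {M : Type*} [AddCommGroup M] [Module B M] [Module K M]
    [IsScalarTower K B M] {D₁ D₂ : Derivation K B M}
    (h : ∀ i, D₁ (coordElt K B n i) = D₂ (coordElt K B n i)) : D₁ = D₂ := by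
  have key : D₁.liftKaehlerDifferential = D₂.liftKaehlerDifferential :=
    (dxBasis K B n).ext fun i => by
      rw [← D_coordElt, Derivation.liftKaehlerDifferential_comp_D,
        Derivation.liftKaehlerDifferential_comp_D, h]
  ext b
  rw [← Derivation.liftKaehlerDifferential_comp_D D₁, key,
    Derivation.liftKaehlerDifferential_comp_D]

/-- Viewing B' as a B-module through σ turns both maps into derivations of B, which étale
coordinates determine. -/
theorem eq_of_eq_on_coord {B' : Type*} [CommRing B'] [Algebra K B'] (σ : B →ₐ[K] B')
    (D₁ D₂ : B →ₗ[K] B') (h₁ : ∀ a b, D₁ (a * b) = σ a * D₁ b + σ b * D₁ a)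
    (h₂ : ∀ a b, D₂ (a * b) = σ a * D₂ b + σ b * D₂ a)
    (h : ∀ i, D₁ (coordElt K B n i) = D₂ (coordElt K B n i)) : D₁ = D₂ := by
  let _ : Algebra B B' := σ.toRingHom.toAlgebra
  have : IsScalarTower K B B' := IsScalarTower.of_algebraMap_eq' σ.comp_algebraMap.symm
  have := derivation_ext_coord (n := n) (D₁ := Derivation.mk' D₁ h₁) (D₂ := Derivation.mk' D₂ h₂) h
  exact congrArg Derivation.toLinearMap this

end EtaleCoordinates

/-! ### The special basis over a ring with étale coordinates -/

section Frame

variable {K : Type*} [Field K] {B : Type*} [CommRing B] [Algebra K B] {k : ℕ} {I : Finset ℕ}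
  [Algebra (MvPolynomial (Fin (k + 2)) K) B] [IsScalarTower K (MvPolynomial (Fin (k + 2)) K) B]
  [Algebra.FormallyEtale (MvPolynomial (Fin (k + 2)) K) B]

variable (K B k I) in
/-- The special basis on an affine chart. -/
noncomputable def derG (i : ℕ) : Derivation K B B :=
  spG k I (coordElt K B (k + 2)) (coordDer K B (k + 2)) i

theorem derG_coordElt (i : ℕ) :
    (fun l => derG K B k I i (coordElt K B (k + 2) l)) =
      spG k I (coordElt K B (k + 2)) (stdPd B k) i := by
  have := map_spG (RingHom.id B)
    (AddMonoidHom.mk' (fun (z : Derivation K B B) l => z (coordElt K B (k + 2) l))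
      fun a b => rfl) (fun _ _ => rfl) k I (coordElt K B (k + 2)) (coordDer K B (k + 2)) i
  refine this.trans ?_
  congr 1
  funext j l
  exact (coordDer_coordElt K B (k + 2) j l).trans (by simp [stdPd, Pi.single_apply, eq_comm])

theorem derG_apply_coordElt (i : ℕ) (l : Fin (k + 2)) :
    derG K B k I i (coordElt K B (k + 2) l) = spG k I (coordElt K B (k + 2)) (stdPd B k) i l :=
  congrFun (derG_coordElt i) l

theorem derG_zero_mem : derG K B k I 0 ∈ focalModule I (coordElt K B (k + 2)) := by
  rw [mem_focalModule, derG_coordElt]; exact fun j h1 h2 => omega_spG_zero _ h1 h2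

theorem derG_one_mem : derG K B k I 1 ∈ focalModule I (coordElt K B (k + 2)) := by
  rw [mem_focalModule, derG_coordElt]; exact fun j h1 h2 => omega_spG_one _ h1 h2

variable (K B k I) in
/-- The derivations `g_0` and `g_1`. -/
noncomputable def derFrame : Set (Derivation K B B) := {derG K B k I 0, derG K B k I 1}

theorem map_derG_coordElt {B' : Type*} [CommRing B'] [Algebra K B'] (σ : B →ₐ[K] B') (i : ℕ)
    (l : Fin (k + 2)) : σ (derG K B k I i (coordElt K B (k + 2) l)) =
      spG k I (fun i => σ (coordElt K B (k + 2) i)) (stdPd B' k) i l := by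
  have e : (fun i => AddMonoidHom.mk' (fun (z : Fin (k + 2) → B) l => σ (z l))
      (fun a b => funext fun l => map_add σ _ _) (stdPd B k i)) = stdPd B' k := by
    funext i j
    simp only [stdPd, AddMonoidHom.mk'_apply, Pi.single_apply]
    split_ifs <;> simp
  have := map_spG σ.toRingHom (AddMonoidHom.mk' (fun (z : Fin (k + 2) → B) l => σ (z l))
    fun a b => funext fun l => map_add σ _ _) (fun b m => funext fun l => map_mul σ _ _) k I
    (coordElt K B (k + 2)) (stdPd B k) i
  rw [e] at this
  rw [derG_apply_coordElt]
  exact congrFun this l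

theorem map_derG {B' : Type*} [CommRing B'] [Algebra K B']
    [Algebra (MvPolynomial (Fin (k + 2)) K) B'] [IsScalarTower K (MvPolynomial (Fin (k + 2)) K) B']
    [Algebra.FormallyEtale (MvPolynomial (Fin (k + 2)) K) B'] (σ : B →ₐ[K] B')
    (hσ : ∀ l, σ (coordElt K B (k + 2) l) = coordElt K B' (k + 2) l) (i : ℕ) (f : B) :
    σ (derG K B k I i f) = derG K B' k I i (σ f) := by
  have := eq_of_eq_on_coord (n := k + 2) σ (σ.toLinearMap ∘ₗ (derG K B k I i).toLinearMap)
    ((derG K B' k I i).toLinearMap ∘ₗ σ.toLinearMap) (fun a b => by simp) (fun a b => by simp)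
    fun l => by
      change σ (derG K B k I i _) = derG K B' k I i (σ _)
      rw [map_derG_coordElt, hσ, derG_apply_coordElt]
      simp only [hσ]
  exact LinearMap.congr_fun this f

/-- A focal derivation along a homomorphism is a combination of `g_0` and `g_1`. -/
theorem focal_derivation_apply {B' : Type*} [CommRing B'] [Algebra K B'] (σ : B →ₐ[K] B')
    (D : B →ₗ[K] B') (hD : ∀ a b, D (a * b) = σ a * D b + σ b * D a)
    (hf : ∀ j, 1 ≤ j → j ≤ k → omega I (fun i => σ (coordElt K B (k + 2) i))
      (fun i => D (coordElt K B (k + 2) i)) j = 0) (f : B) :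
    D f = D (coordElt K B (k + 2) (retIdx k I k)) * σ (derG K B k I 0 f) +
      D (coordElt K B (k + 2) (newIdx k k)) * σ (derG K B k I 1 f) := by
  set α := D (coordElt K B (k + 2) (retIdx k I k))
  set β := D (coordElt K B (k + 2) (newIdx k k))
  have key : D = α • (σ.toLinearMap ∘ₗ (derG K B k I 0).toLinearMap) +
      β • (σ.toLinearMap ∘ₗ (derG K B k I 1).toLinearMap) := by
    refine eq_of_eq_on_coord (n := k + 2) σ _ _ hD (fun a b => ?_) fun l => ?_
    · simp; ring
    · have h1 := congrFun (eq_of_omega_eq_zero hf) l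
      have h2 := fun i => map_derG_coordElt (I := I) σ i l
      simpa [h2, α, β] using h1
  conv_lhs => rw [key]
  rfl

theorem wordOrd_focal {𝔪 : Ideal B} {a : Derivation K B B}
    (ha : a ∈ focalModule I (coordElt K B (k + 2))) (m : ℕ) (f : B)
    (h : WordOrd (derFrame K B k I) 𝔪 (m + 1) f) : WordOrd (derFrame K B k I) 𝔪 m (a f) := by
  have := focal_derivation_apply (I := I) (AlgHom.id K B) a.toLinearMap a.leibniz
    (mem_focalModule.mp ha) f
  change a f = a _ * derG K B k I 0 f + a _ * derG K B k I 1 f at this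
  rw [this]
  exact ((h.2 _ (Or.inl rfl)).mul_left _).add ((h.2 _ (Or.inr rfl)).mul_left _)

end Frame

/-! ### Closed points as K-points -/

section ResidueField

/-- By the Nullstellensatz the residue field is finite over K, hence equal to K. -/
theorem exists_algHom_ker_eq {K : Type*} [Field K] [IsAlgClosed K] {B : Type*} [CommRing B]
    [Algebra K B] [Algebra.FiniteType K B] (m : Ideal B) [m.IsMaximal] :
    ∃ e : B →ₐ[K] K, RingHom.ker e = m := by
  let := Ideal.Quotient.field m
  have : Module.Finite K (B ⧸ m) := finite_of_finite_type_of_isJacobsonRing K (B ⧸ m)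
  let e := AlgEquiv.ofBijective (Algebra.ofId K (B ⧸ m))
    IsAlgClosed.algebraMap_bijective_of_isIntegral
  refine ⟨(e.symm : (B ⧸ m) →ₐ[K] K).comp (Ideal.Quotient.mkₐ K m), ?_⟩
  ext b
  simp [RingHom.mem_ker, Ideal.Quotient.eq_zero_iff_mem]

end ResidueField

/-! ### Word orders against focal orders, algebraic setting -/

section AlgebraicCurves

variable {K : Type u} [Field K] {B : Type u} [CommRing B] [Algebra K B] {k : ℕ} {I : Finset ℕ}
  [Algebra (MvPolynomial (Fin (k + 2)) K) B] [IsScalarTower K (MvPolynomial (Fin (k + 2)) K) B]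
  [Algebra.FormallyEtale (MvPolynomial (Fin (k + 2)) K) B] {m : Ideal B}

theorem WordOrd.iterate {C : Type*} [CommRing C] [Algebra K C] {d : Derivation K C C}
    {𝔫 : Ideal C} {N : ℕ} {c : C} (h : WordOrd {d} 𝔫 N c) {n : ℕ} (hn : n < N) :
    (fun c => d c)^[n] c ∈ 𝔫 := by
  induction n generalizing N c with
  | zero =>
    obtain ⟨N, rfl⟩ : ∃ l, N = l + 1 := ⟨N - 1, by omega⟩
    exact h.1
  | succ n ih =>
    obtain ⟨N, rfl⟩ : ∃ l, N = l + 1 := ⟨N - 1, by omega⟩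
    exact ih (h.2 d rfl) (by omega)

theorem wordOrd_focalCurve (Γ : FocalCurve (K := K) I (coordElt K B (k + 2)) m) {N : ℕ} {f : B}
    (h : WordOrd (derFrame K B k I) m N f) : WordOrd {Γ.d} (RingHom.ker Γ.o) N (Γ.γ f) := by
  induction N generalizing f with
  | zero => trivial
  | succ N ih =>
    refine ⟨?_, ?_⟩
    · have : f ∈ RingHom.ker (Γ.o.comp Γ.γ) := by rw [Γ.γ_o]; exact h.1
      exact this
    · rintro _ rfl
      have := focal_derivation_apply (I := I) Γ.γ (Γ.d.toLinearMap ∘ₗ Γ.γ.toLinearMap)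
        (fun a b => by simp) (focal_iff.mp Γ.focal) f
      change Γ.d (Γ.γ f) = _ at this
      rw [this]
      exact ((ih (h.2 _ (Or.inl rfl))).mul_left _).add ((ih (h.2 _ (Or.inr rfl))).mul_left _)

theorem le_algFocalOrder {N : ℕ} {f : B} (h : WordOrd (derFrame K B k I) m N f) :
    N ≤ algFocalOrder K I (coordElt K B (k + 2)) m f :=
  le_iInf fun Γ => le_iInf₂ fun n hn => by
    by_contra hlt
    exact hn ((wordOrd_focalCurve Γ h).iterate (by simpa using hlt))

/-- The differentials of C are those of A extended to C, so a derivation of A, composed into C,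
extends linearly. -/
theorem exists_derivation_extending {K A C : Type*} [CommRing K] [CommRing A] [CommRing C]
    [Algebra K A] [Algebra K C] [Algebra A C] [IsScalarTower K A C] [Algebra.FormallyEtale A C]
    (D : Derivation K A A) :
    ∃ D' : Derivation K C C, ∀ a, D' (algebraMap A C a) = algebraMap A C (D a) := by
  let D₀ : Derivation K A C := (Algebra.linearMap A C).compDer D
  let l := (D₀.liftKaehlerDifferential.liftBaseChange C) ∘ₗ
    (KaehlerDifferential.tensorKaehlerEquivOfFormallyEtale K A C).symm.toLinearMap
  refine ⟨l.compDer (KaehlerDifferential.D K C), fun a => ?_⟩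
  change D₀.liftKaehlerDifferential.liftBaseChange C
    ((KaehlerDifferential.tensorKaehlerEquivOfFormallyEtale K A C).symm
      (KaehlerDifferential.D K C (algebraMap A C a))) = _
  rw [KaehlerDifferential.tensorKaehlerEquivOfFormallyEtale_symm_D_algebraMap]
  simp [D₀]

theorem exists_ringHom_tensorProduct {P A B T : Type*} [CommRing P] [CommRing A] [CommRing B]
    [CommRing T] [Algebra P A] [Algebra P B] (f : A →+* T) (g : B →+* T)
    (h : f.comp (algebraMap P A) = g.comp (algebraMap P B)) :
    ∃ o : TensorProduct P A B →+* T, (∀ a, o (algebraMap A (TensorProduct P A B) a) = f a) ∧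
      ∀ b, o (Algebra.TensorProduct.includeRight b) = g b := by
  let _ : Algebra P T := (f.comp (algebraMap P A)).toAlgebra
  let f' : A →ₐ[P] T := { f with commutes' := fun _ => rfl }
  let g' : B →ₐ[P] T := { g with commutes' := fun r => (RingHom.congr_fun h r).symm }
  refine ⟨(Algebra.TensorProduct.lift f' g' fun _ _ => Commute.all _ _).toRingHom, fun a => ?_,
    fun b => ?_⟩
  · exact (Algebra.TensorProduct.lift_tmul f' g' _ a 1).trans (by rw [map_one, mul_one]; rfl)
  · exact (Algebra.TensorProduct.lift_tmul f' g' _ 1 b).trans (by rw [map_one, one_mul]; rfl)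

open Polynomial TensorProduct in
-- Pull the polynomial curve back along the étale coordinate map. The fibre product is étale over
-- the line, so d/dt lifts to it; the parameter value 0 and the point e agree in affine space and
-- give o. The coordinates restrict to the q_i, so their iterated derivatives are computed on the
-- line.
theorem exists_focalCurve {e : B →ₐ[K] K} (he : RingHom.ker e = m)
    [Algebra.Etale (MvPolynomial (Fin (k + 2)) K) B] {q : Fin (k + 2) → K[X]}
    (h0 : ∀ i, (q i).eval 0 = e (coordElt K B (k + 2) i))
    (hq : ∀ j, 1 ≤ j → j ≤ k → omega I q (fun i => derivative (q i)) j = 0)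
    (hn : derivative (q (newIdx k k)) = 1) :
    ∃ Γ : FocalCurve (K := K) I (coordElt K B (k + 2)) m, ∀ n i,
      Γ.o ((fun c => Γ.d c)^[n] (Γ.γ (coordElt K B (k + 2) i))) =
        (derivative^[n] (q i)).eval 0 := by
  let P := MvPolynomial (Fin (k + 2)) K
  let _ : Algebra P K[X] := (MvPolynomial.aeval q).toRingHom.toAlgebra
  have : IsScalarTower K P K[X] :=
    IsScalarTower.of_algebraMap_eq' (MvPolynomial.aeval q).comp_algebraMap.symm
  let C := TensorProduct P K[X] B
  obtain ⟨d, hd₀⟩ := exists_derivation_extending (K := K) (A := K[X]) (C := C) derivative'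
  have hd : ∀ F : K[X], d (algebraMap K[X] C F) = algebraMap K[X] C (derivative F) := hd₀
  obtain ⟨o', ho, hoγ⟩ := exists_ringHom_tensorProduct (P := P) (Polynomial.evalRingHom (0 : K))
    e.toRingHom (MvPolynomial.ringHom_ext (fun c => by
      change ((MvPolynomial.aeval q) (MvPolynomial.C c)).eval 0 =
        e (algebraMap P B (MvPolynomial.C c))
      rw [← MvPolynomial.algebraMap_eq, ← IsScalarTower.algebraMap_apply, e.commutes]
      simp) fun i => by
      refine Eq.trans ?_ (h0 i)
      change ((MvPolynomial.aeval q) (MvPolynomial.X i)).eval 0 = _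
      simp)
  let o : C →ₐ[K] K := { o' with
    commutes' := fun c => (ho (Polynomial.C c)).trans (by simp) }
  let γ : B →ₐ[K] C := (Algebra.TensorProduct.includeRight : B →ₐ[P] C).restrictScalars K
  have hγ : ∀ i, γ (coordElt K B (k + 2) i) = algebraMap K[X] C (q i) := fun i => by
    have := Algebra.TensorProduct.tmul_one_eq_one_tmul (A := K[X]) (B := B)
      (MvPolynomial.X i : P)
    refine this.symm.trans ?_
    change (MvPolynomial.aeval q (MvPolynomial.X i)) ⊗ₜ[P] (1 : B) = q i ⊗ₜ[P] 1
    rw [MvPolynomial.aeval_X]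
  have hit : ∀ n (F : K[X]), (fun c => d c)^[n] (algebraMap K[X] C F) =
      algebraMap K[X] C (derivative^[n] F) := by
    intro n
    induction n with
    | zero => intro F; rfl
    | succ n ih =>
      intro F
      rw [Function.iterate_succ_apply, Function.iterate_succ_apply, ← ih, hd]
  have hd' : ∀ i, d (γ (coordElt K B (k + 2) i)) = algebraMap K[X] C (derivative (q i)) :=
    fun i => by rw [hγ, hd]
  have haeval : (Polynomial.aeval (R := K) (algebraMap K[X] C X)).toRingHom = algebraMap K[X] C :=
    Polynomial.ringHom_ext (fun c => by
      change Polynomial.aeval (algebraMap K[X] C X) (Polynomial.C c) = _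
      rw [Polynomial.aeval_C, ← Polynomial.algebraMap_eq, ← IsScalarTower.algebraMap_apply])
      (by simp)
  have hfocal : ∀ j, 1 ≤ j → j ≤ k → omega I (fun i => γ (coordElt K B (k + 2) i))
      (fun i => d (γ (coordElt K B (k + 2) i))) j = 0 := by
    intro j h1 h2
    simp only [hγ, hd]
    rw [← map_omega (algebraMap K[X] C) q (fun i => derivative (q i)), hq j h1 h2, map_zero]
  refine ⟨FocalCurve.mk C (algebraMap K[X] C X) ?_ d (by rw [hd]; simp) o ((ho X).trans (by simp))
    γ ?_ ⟨newIdx k k, ?_⟩ (focal_iff.mpr hfocal), fun n i => ?_⟩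
  · rw [haeval, RingHom.etale_algebraMap]
    infer_instance
  · rw [← he]
    congr 1
    ext b
    exact hoγ b
  · rw [hd', hn, map_one, map_one]; exact one_ne_zero
  · change o ((fun c => d c)^[n] (γ (coordElt K B (k + 2) i))) = _
    rw [hγ, hit]
    exact ho _

open Polynomial in
/-- Bounds for the vertical orders and for the word orders of the coordinate functions, by the
orders of these functions along the generic curve. -/
theorem exists_algOrders [IsAlgClosed K] [CharZero K]
    [Algebra.Etale (MvPolynomial (Fin (k + 2)) K) B] (I : Finset ℕ) (m : Ideal B) [m.IsMaximal] :
    ∃ μ : ℕ → ℕ,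
      (∀ j, 1 ≤ j → j ≤ k → algVerticalOrder K I (coordElt K B (k + 2)) m j ≤ μ j) ∧
      ∀ j, 1 ≤ j → j ≤ k → WordOrd (derFrame K B k I) m (μ j)
        (if j ∈ I then coordElt K B (k + 2) (newIdx k j) else 1) := by
  have : Algebra.FiniteType K B := Algebra.FiniteType.trans (S := MvPolynomial (Fin (k + 2)) K)
    inferInstance inferInstance
  obtain ⟨e, he⟩ := exists_algHom_ker_eq (K := K) m
  obtain ⟨q, h0, hq, hr, hn⟩ :=
    exists_generic_curve k I fun i => e (coordElt K B (k + 2) i)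
  obtain ⟨Γ, hΓ⟩ := exists_focalCurve he h0 hq hn
  refine ⟨fun j => if j ∈ I then (q (newIdx k j)).rootMultiplicity 0 else 0, ?_, ?_⟩
  · intro j h1 hj
    refine (iInf_le _ Γ).trans ?_
    beta_reduce
    split_ifs with h
    · have hne := newIdx_ne_zero_of_generic hq hr hn (Nat.zero_le k) j (Nat.zero_le j) hj
      have h := (lt_rootMultiplicity_iff_isRoot_iterate_derivative (t := 0)
        (n := (q (newIdx k j)).rootMultiplicity 0) hne).not.mp (lt_irrefl _)
      push Not at h
      obtain ⟨l, hl, h⟩ := h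
      refine (iInf₂_le l ?_).trans (by exact_mod_cast hl)
      rw [hΓ]
      exact h
    · refine iInf₂_le 0 ?_
      simp
  · intro j h1 hj
    beta_reduce
    split_ifs
    · refine wordOrd_newIdx ?_ hq hr hn (fun i hi => ?_) (Nat.zero_le k) j (Nat.zero_le j) hj
      · rintro a (rfl | rfl)
        · exact mem_focalModule.mp derG_zero_mem
        · exact mem_focalModule.mp derG_one_mem
      · rw [← he]
        exact (h0 i).symm.trans hi
    · trivial

end AlgebraicCurves

end Monster

namespace Monster

/-! ### Restriction, vanishing at a point, and gluing of functions -/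

section ChartRings

open AlgebraicGeometry CategoryTheory

variable {K : Type u} [Field K] {X : Scheme.{u}} {n : ℕ} (Φ : X ⟶ Spec (polyRing K n))

theorem secRes_coordHom {V W : X.Opens} (hVW : V ≤ W) (p : MvPolynomial (Fin n) K) :
    secRes Φ hVW (coordHom Φ W p) = coordHom Φ V p := by
  have h : ((Scheme.ΓSpecIso (polyRing K n)).inv ≫ Φ.appLE ⊤ W le_top) ≫
      X.presheaf.map (homOfLE hVW).op =
      (Scheme.ΓSpecIso (polyRing K n)).inv ≫ Φ.appLE ⊤ V le_top := by
    rw [Category.assoc]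
    exact congrArg (_ ≫ ·) (Scheme.Hom.appLE_map Φ _ (homOfLE hVW).op)
  exact congrArg (fun f => f.hom p) h

/-- Restriction of functions, as a homomorphism of algebras. -/
noncomputable def secResAlg {V W : X.Opens} (hVW : V ≤ W) : SecRing Φ W →ₐ[K] SecRing Φ V :=
  { secRes Φ hVW with commutes' := fun c => secRes_coordHom Φ hVW (MvPolynomial.C c) }

theorem secRes_secRes {U V W : X.Opens} (hUV : U ≤ V) (hVW : V ≤ W) (f : SecRing Φ W) :
    secRes Φ hUV (secRes Φ hVW f) = secRes Φ (hUV.trans hVW) f := by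
  have h : X.presheaf.map (homOfLE hVW).op ≫ X.presheaf.map (homOfLE hUV).op =
      X.presheaf.map (homOfLE (hUV.trans hVW)).op := by
    rw [← Functor.map_comp]; rfl
  exact congrArg (fun g => g.hom f) h

theorem secRes_coordElt {V W : X.Opens} (hVW : V ≤ W) (i : Fin n) :
    secRes Φ hVW (coordElt K (SecRing Φ W) n i) = coordElt K (SecRing Φ V) n i :=
  secRes_coordHom Φ hVW (MvPolynomial.X i)

theorem mem_pointIdeal_iff (V : X.affineOpens) (p : X) (hp : p ∈ V.1) (f : SecRing Φ V.1) :
    f ∈ pointIdeal Φ V p hp ↔ p ∉ X.basicOpen (U := V.1) f := by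
  refine not_iff_not.mp ((?_ : _ ↔ p ∈ X.basicOpen (U := V.1) f).trans not_not.symm)
  have h := V.2.fromSpec_preimage_basicOpen (X := X) f
  have h' : V.2.primeIdealOf ⟨p, hp⟩ ∈ V.2.fromSpec ⁻¹ᵁ X.basicOpen (U := V.1) f ↔
      V.2.primeIdealOf ⟨p, hp⟩ ∈ PrimeSpectrum.basicOpen (R := Γ(X, V.1)) f :=
    iff_of_eq (congrArg (V.2.primeIdealOf ⟨p, hp⟩ ∈ ·) h)
  have h'' : V.2.primeIdealOf ⟨p, hp⟩ ∈ V.2.fromSpec ⁻¹ᵁ X.basicOpen (U := V.1) f ↔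
      p ∈ X.basicOpen (U := V.1) f := by
    change V.2.fromSpec (V.2.primeIdealOf ⟨p, hp⟩) ∈ X.basicOpen (U := V.1) f ↔ _
    rw [V.2.fromSpec_primeIdealOf]
  exact h'.symm.trans h''

theorem secRes_mem_pointIdeal_iff {V V' : X.affineOpens} (hV : V'.1 ≤ V.1) (p : X) (hp : p ∈ V'.1)
    (f : SecRing Φ V.1) :
    secRes Φ hV f ∈ pointIdeal Φ V' p hp ↔ f ∈ pointIdeal Φ V p (hV hp) := by
  rw [mem_pointIdeal_iff, mem_pointIdeal_iff]
  have h : X.basicOpen (U := V'.1) (secRes Φ hV f) = V'.1 ⊓ X.basicOpen (U := V.1) f :=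
    X.basicOpen_res f (homOfLE hV).op
  rw [h]
  exact not_congr ⟨fun h => h.2, fun h => ⟨hp, h⟩⟩

theorem exists_affineOpen_le {W : X.Opens} {p : X} (hp : p ∈ W) :
    ∃ V : X.affineOpens, p ∈ V.1 ∧ V.1 ≤ W := by
  obtain ⟨V, hV, hpV, hVW⟩ := exists_isAffineOpen_mem_and_subset hp
  exact ⟨⟨V, hV⟩, hpV, hVW⟩

theorem eq_of_secRes_eq {W : X.Opens} {s t : SecRing Φ W}
    (h : ∀ (V : X.affineOpens) (hV : V.1 ≤ W), secRes Φ hV s = secRes Φ hV t) : s = t := by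
  refine X.sheaf.eq_of_locally_eq' (fun V : {V : X.affineOpens // V.1 ≤ W} => V.1.1) W
    (fun V => homOfLE V.2) (fun p hp => ?_) s t fun V => h V.1 V.2
  obtain ⟨V, hpV, hV⟩ := exists_affineOpen_le hp
  exact TopologicalSpace.Opens.mem_iSup.mpr ⟨⟨V, hV⟩, hpV⟩

/-- Compatible functions on the affine open subsets of `W` come from a function on `W`. -/
theorem exists_glue {W : X.Opens} (s : ∀ V : X.affineOpens, V.1 ≤ W → SecRing Φ V.1)
    (hs : ∀ (V V' : X.affineOpens) (hV : V.1 ≤ W) (hV' : V'.1 ≤ V.1),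
      secRes Φ hV' (s V hV) = s V' (hV'.trans hV)) :
    ∃ t : SecRing Φ W, ∀ (V : X.affineOpens) (hV : V.1 ≤ W), secRes Φ hV t = s V hV := by
  obtain ⟨t, ht, -⟩ := X.sheaf.existsUnique_gluing'
    (fun V : {V : X.affineOpens // V.1 ≤ W} => V.1.1) W (fun V => homOfLE V.2) (fun p hp => by
      obtain ⟨V, hpV, hV⟩ := exists_affineOpen_le hp
      exact TopologicalSpace.Opens.mem_iSup.mpr ⟨⟨V, hV⟩, hpV⟩) (fun V => s V.1 V.2) (by
      intro V V'
      change secRes Φ (inf_le_left : V.1.1 ⊓ V'.1.1 ≤ V.1.1) (s V.1 V.2) =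
        secRes Φ (inf_le_right : V.1.1 ⊓ V'.1.1 ≤ V'.1.1) (s V'.1 V'.2)
      refine eq_of_secRes_eq Φ fun T hT => ?_
      rw [secRes_secRes, secRes_secRes, hs V.1 T V.2, hs V'.1 T V'.2])
  exact ⟨t, fun V hV => ht ⟨V, hV⟩⟩

end ChartRings

/-! ### The decomposition, algebraic setting -/

section Decomposition

open AlgebraicGeometry CategoryTheory

variable {K : Type u} [Field K] {X : Scheme.{u}} {k : ℕ} {Φ : X ⟶ Spec (polyRing K (k + 2))}
  {I : Finset ℕ}

/-- The components of a vector field on an affine open set. -/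
noncomputable def vfComp {W : X.Opens} (z : VectorFieldOn Φ W) (V : X.affineOpens) (hV : V.1 ≤ W) :
    Fin (k + 2) → SecRing Φ V.1 := fun i => z.der V hV (chartCoord Φ V.1 i)

theorem secRes_omega {W : X.Opens} (z : VectorFieldOn Φ W) {V V' : X.affineOpens} (hV : V.1 ≤ W)
    (hV' : V'.1 ≤ V.1) (j : ℕ) : secRes Φ hV' (omega I (chartCoord Φ V.1) (vfComp z V hV) j) =
      omega I (chartCoord Φ V'.1) (vfComp z V' (hV'.trans hV)) j := by
  rw [map_omega]
  have h1 : ∀ i, secRes Φ hV' (chartCoord Φ V.1 i) = chartCoord Φ V'.1 i :=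
    secRes_coordElt Φ hV'
  have h2 : ∀ i, secRes Φ hV' (vfComp z V hV i) = vfComp z V' (hV'.trans hV) i := fun i => by
    rw [vfComp, z.compat V V' hV hV', h1]; rfl
  simp only [h1, h2]

variable [Etale Φ]

theorem secRes_derG {V V' : X.affineOpens} (hV : V'.1 ≤ V.1) (i : ℕ) (f : SecRing Φ V.1) :
    secRes Φ hV (derG K (SecRing Φ V.1) k I i f) =
      derG K (SecRing Φ V'.1) k I i (secRes Φ hV f) :=
  map_derG (secResAlg Φ hV) (secRes_coordElt Φ hV) i f

/-- Restriction commutes with g_0 and g_1 and detects vanishing at p, so word orders do not depend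
on the affine neighbourhood. -/
theorem wordOrd_secRes_iff {V V' : X.affineOpens} (hV : V'.1 ≤ V.1) {p : X} (hp : p ∈ V'.1)
    {m : ℕ} {f : SecRing Φ V.1} :
    WordOrd (derFrame K (SecRing Φ V'.1) k I) (pointIdeal Φ V' p hp) m (secRes Φ hV f) ↔
      WordOrd (derFrame K (SecRing Φ V.1) k I) (pointIdeal Φ V p (hV hp)) m f :=
  WordOrd.map_iff (secRes Φ hV) (secRes_mem_pointIdeal_iff Φ hV p hp) (secRes_derG hV 0)
    (secRes_derG hV 1)

theorem derivation_sum_apply {R A : Type*} [CommRing R] [CommRing A] [Algebra R A] {ι : Type*}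
    (s : Finset ι) (D : ι → Derivation R A A) (a : A) : (∑ i ∈ s, D i) a = ∑ i ∈ s, D i a :=
  map_sum ((Pi.evalAddMonoidHom (fun _ : A => A) a).comp Derivation.coeFnAddMonoidHom) D s

theorem algebraic_decomposition [IsAlgClosed K] [CharZero K] {W : X.Opens} {p : X} (hp : p ∈ W)
    (hcl : IsClosed ({p} : Set X)) {h : ℕ} (hh : 1 ≤ h) (z : VectorFieldOn Φ W)
    (hz : IsSmallGrowthSection Φ I h z) :
    ∃ (w : VectorFieldOn Φ W) (c : ℕ → SecRing Φ W),
      IsLieSquareSection Φ I 3 w ∧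
      (∀ i ∈ Finset.Icc 4 (min h (k + 1)), ∀ (V : X.affineOpens) (hV : V.1 ≤ W) (hp : p ∈ V.1),
        eNum k (algVerticalOrder K I (chartCoord Φ V.1) (pointIdeal Φ V p hp)) h i ≤
          algFocalOrder K I (chartCoord Φ V.1) (pointIdeal Φ V p hp) (secRes Φ hV (c i))) ∧
      ∀ (V : X.affineOpens) (hV : V.1 ≤ W),
        z.der V hV = w.der V hV + ∑ i ∈ Finset.Icc 4 (min h (k + 1)),
          secRes Φ hV (c i) • algG Φ I V i := by
  have hglue : ∀ i, ∃ t : SecRing Φ W, ∀ (V : X.affineOpens) (hV : V.1 ≤ W), secRes Φ hV t =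
      (spSign k I i : SecRing Φ V.1) *
        omega I (chartCoord Φ V.1) (vfComp z V hV) (k + 2 - i) := fun i =>
    exists_glue Φ _ fun V V' hV hV' => by
      rw [map_mul, map_intCast, secRes_omega]
  choose c hc using hglue
  let w : VectorFieldOn Φ W :=
    { der := fun V hV => z.der V hV - ∑ i ∈ Finset.Icc 4 (min h (k + 1)),
        secRes Φ hV (c i) • algG Φ I V i
      compat := fun V V' hV hV' a => by
        have key : ∀ i, secRes Φ hV' ((secRes Φ hV (c i) • algG Φ I V i) a) =
            (secRes Φ (hV'.trans hV) (c i) • algG Φ I V' i) (secRes Φ hV' a) := fun i => by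
          rw [Derivation.smul_apply, Derivation.smul_apply, smul_eq_mul, smul_eq_mul, map_mul,
            secRes_secRes]
          congr 1
          exact secRes_derG hV' i a
        rw [Derivation.sub_apply, Derivation.sub_apply, map_sub, z.compat V V' hV hV',
          derivation_sum_apply, derivation_sum_apply, map_sum]
        simp only [key] }
  refine ⟨w, c, fun q hq => ?_, fun i hi V hV hpV => ?_, fun V hV => (sub_add_cancel _ _).symm⟩
  · obtain ⟨V, hV, hqV, hzV⟩ := hz q hq
    refine ⟨V, hV, hqV, ?_⟩
    -- Only the vanishing of the coefficients with i > h is used here, so the ideal and the orders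
    -- are dummies.
    have hG := growthBound_of_mem_smallGrowthModule (S := derFrame K (SecRing Φ V.1) k I) (𝔪 := ⊥)
      (μ := fun _ => 0) (fun _ _ _ => trivial) (fun a ha => wordOrd_focal ha) hh hzV
    refine mem_lieSquareModule_three (derG_zero_mem (B := SecRing Φ V.1)) derG_one_mem
      ((derG_apply_coordElt _ _).trans (spG_zero_retIdx _))
      ((derG_apply_coordElt _ _).trans (spG_zero_newIdx _))
      ((derG_apply_coordElt _ _).trans (spG_one_newIdx _)) fun j h1 hj => ?_
    have e0 : (fun l => w.der V hV (chartCoord Φ V.1 l)) = vfComp z V hV -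
        ∑ i ∈ Finset.Icc 4 (min h (k + 1)),
          secRes Φ hV (c i) • spG k I (chartCoord Φ V.1) (stdPd (SecRing Φ V.1) k) i := by
      funext l
      rw [Pi.sub_apply, Finset.sum_apply]
      change (z.der V hV - ∑ i ∈ Finset.Icc 4 (min h (k + 1)),
        secRes Φ hV (c i) • algG Φ I V i) (chartCoord Φ V.1 l) = _
      rw [Derivation.sub_apply, derivation_sum_apply]
      congr 1
      refine Finset.sum_congr rfl fun i _ => ?_
      rw [Derivation.smul_apply, Pi.smul_apply]
      congr 1
      exact derG_apply_coordElt i l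
    change omega I (chartCoord Φ V.1) (fun l => w.der V hV (chartCoord Φ V.1 l)) j = 0
    rw [e0, omega_sub, omega_sum]
    have e : ∀ i ∈ Finset.Icc 4 (min h (k + 1)), omega I (chartCoord Φ V.1)
        (secRes Φ hV (c i) • spG k I (chartCoord Φ V.1) (stdPd (SecRing Φ V.1) k) i) j =
        if i = k + 2 - j then omega I (chartCoord Φ V.1) (vfComp z V hV) j else 0 := by
      intro i hi
      rw [Finset.mem_Icc, le_min_iff] at hi
      rw [omega_smul, omega_spG _ (by omega) hi.2.2 h1 (by omega), hc]
      by_cases hij : i = k + 2 - j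
      · have hij' : j = k + 2 - i := by omega
        have hsq : (spSign k I i : SecRing Φ V.1) * spSign k I i = 1 := by
          exact_mod_cast congrArg (Int.cast : ℤ → SecRing Φ V.1) (spSign_mul_self k I i)
        rw [if_pos hij', if_pos hij, mul_right_comm, hsq, one_mul, ← hij']
      · rw [if_neg hij, if_neg (by omega), mul_zero]
    rw [Finset.sum_congr rfl e, Finset.sum_ite_eq']
    split_ifs with hm
    · exact sub_self _
    · rw [Finset.mem_Icc, le_min_iff] at hm
      have h0 := (hG (k + 2 - j) (by omega) (by omega)).1 (by omega)
      rw [show k + 2 - (k + 2 - j) = j by omega] at h0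
      rw [sub_zero]
      exact h0
  · rw [Finset.mem_Icc, le_min_iff] at hi
    have : (pointIdeal Φ V p hpV).IsMaximal :=
      V.2.primeIdealOf_isMaximal_of_isClosed ⟨p, hpV⟩ hcl
    obtain ⟨μ, hμ, hμ'⟩ := exists_algOrders (K := K) (k := k) I (pointIdeal Φ V p hpV)
    refine (eNum_le_eNat h i hμ hi.2.2).trans (le_algFocalOrder ?_)
    -- The field z is known to be generated by brackets on some V₀, while the bound is wanted on a
    -- given V; word orders are carried across through an affine V' in the intersection.
    obtain ⟨V₀, hV₀, hpV₀, hzV₀⟩ := hz p hp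
    obtain ⟨V', hpV', hV'⟩ := exists_affineOpen_le (W := V.1 ⊓ V₀.1) ⟨hpV, hpV₀⟩
    have h1 : V'.1 ≤ V.1 := hV'.trans inf_le_left
    have h2 : V'.1 ≤ V₀.1 := hV'.trans inf_le_right
    have hG := growthBound_of_mem_smallGrowthModule (S := derFrame K (SecRing Φ V₀.1) k I)
      (𝔪 := pointIdeal Φ V₀ p hpV₀) (μ := μ) (fun j hj1 hj2 => by
        rw [← wordOrd_secRes_iff h2 hpV']
        have := (wordOrd_secRes_iff h1 hpV').mpr (hμ' j hj1 hj2)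
        split_ifs at this ⊢
        · rw [secRes_coordElt] at this
          rw [secRes_coordElt]
          exact this
        · rwa [map_one] at this ⊢) (fun a ha => wordOrd_focal ha) hh hzV₀
    have hG' := (hG i (by omega) hi.2.2).2
    rw [← wordOrd_secRes_iff h2 hpV'] at hG'
    have hG'' := secRes_omega (I := I) z hV₀ h2 (k + 2 - i)
    rw [← secRes_omega (I := I) z hV h1 (k + 2 - i)] at hG''
    change WordOrd _ _ _ (secRes Φ h2 (omega I (chartCoord Φ V₀.1) (vfComp z V₀ hV₀) _)) at hG'
    rw [hG'', wordOrd_secRes_iff h1 hpV'] at hG'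
    rw [hc]
    exact hG'.mul_left _

end Decomposition

end Monster

open AlgebraicGeometry CategoryTheory Monster in
theorem mainTheorem2 :
    (∀ (𝕜 : Type u) [RCLike 𝕜] (k : ℕ) (I : Finset ℕ), I ⊆ Finset.Icc 1 k →
      ∀ (U : Set (𝕜 × 𝕜)), IsOpen U →
      ∀ (W : Set (Fin (k + 2) → 𝕜)), IsOpen W → W ⊆ chart 𝕜 U k →
      ∀ p ∈ W, ∀ h : ℕ, 3 ≤ h →
      ∀ z : (Fin (k + 2) → 𝕜) → (Fin (k + 2) → 𝕜), smallGrowthSheaf k I h W z →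
      ∃ (w : (Fin (k + 2) → 𝕜) → (Fin (k + 2) → 𝕜)) (c : ℕ → (Fin (k + 2) → 𝕜) → 𝕜),
        lieSquareSheaf k I 3 W w ∧
        (∀ i ∈ Finset.Icc 4 (min h (k + 1)), ContDiffOn 𝕜 ∞ (c i) W ∧
          eNum k (verticalOrder I p) h i ≤ focalOrder I p (c i)) ∧
        ∀ y ∈ W, z y = w y + ∑ i ∈ Finset.Icc 4 (min h (k + 1)), c i y • anG 𝕜 k I i y) ∧
    (∀ (K : Type u) [Field K] [IsAlgClosed K] [CharZero K] (k : ℕ) (I : Finset ℕ),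
      I ⊆ Finset.Icc 1 k →
      ∀ (U : Scheme.{u}) (φ : U ⟶ Spec (polyRing K 2)) [Etale φ],
      ∀ (W : (algChart U k).Opens), ∀ p ∈ W, IsClosed ({p} : Set (algChart U k)) →
      ∀ h : ℕ, 3 ≤ h →
      ∀ z : VectorFieldOn (algCoords φ k) W,
        IsSmallGrowthSection (algCoords φ k) I h z →
      ∃ (w : VectorFieldOn (algCoords φ k) W)
        (c : ℕ → SecRing (algCoords φ k) W),
        IsLieSquareSection (algCoords φ k) I 3 w ∧
        (∀ i ∈ Finset.Icc 4 (min h (k + 1)), ∀ (V : (algChart U k).affineOpens)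
          (hV : V.1 ≤ W) (hp : p ∈ V.1),
          eNum k
              (algVerticalOrder K I (chartCoord (algCoords φ k) V.1)
                (pointIdeal (algCoords φ k) V p hp)) h i ≤
            algFocalOrder K I (chartCoord (algCoords φ k) V.1)
              (pointIdeal (algCoords φ k) V p hp)
              (secRes (algCoords φ k) hV (c i))) ∧
        ∀ (V : (algChart U k).affineOpens) (hV : V.1 ≤ W),
          z.der V hV = w.der V hV + ∑ i ∈ Finset.Icc 4 (min h (k + 1)),
            secRes (algCoords φ k) hV (c i) •
              algG (algCoords φ k) I V i) :=
  ⟨fun _ _ _ _ _ _ _ _ hW _ _ hp _ hh _ hz =>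
    analytic_decomposition hW hp (by omega) hz,
  fun _ _ _ _ _ _ _ _ _ _ _ _ hp hcl _ hh z hz =>
    algebraic_decomposition hp hcl (by omega) z hz⟩
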